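/- **Theorem.** Let $G$ be a simple graph on $12$ vertices such that $(G,\overline{G})$ is PT12, i.e. $G$ is planar and its complement $\overline{G}$ is toroidal. Then $G$ has no separating 4-cycle whose deletion leaves two subgraphs of order $4$. That is, there is no (not necessarily induced) cycle $C$ of length $4$ in $G$ for which $V(G)\setminus V(C)$ is the disjoint union of two sets $A$ and $B$ with $|A|=|B|=4$ and no edge of $G$ between $A$ and $B$; the subgraphs induced by $A$ and by $B$ need not be connected. Here a graph is *planar* (respectively *toroidal*) if it can be embedded without crossings in the sphere (respectively the torus, so planar graphs are toroidal). Embeddings are described combinatorially, by rotation systems (a cyclic ordering of the edges at each vertex): a finite graph with $c$ connected components embeds in the sphere with $k$ handles if it has a rotation system whose total genus $\gamma$, defined by $|V|-|E|+|F|=2c-2\gamma$, is at most $k$; $F$ consists of the faces traced out by the rotation system, with one face for each isolated vertex. -/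

import Mathlib

/-- A rotation system on a graph `G`: at every vertex a cyclic order of the darts (directed edges)
leaving it.  `rot` sends a dart to the next dart around its initial vertex; the last field says that
the darts at one vertex form a single cycle of `rot`.  Rotation systems describe exactly the
cellular embeddings of graphs in closed oriented surfaces. -/
structure RotationSystem {V : Type*} (G : SimpleGraph V) where
  rot : Equiv.Perm G.Dart
  fst_rot : ∀ d : G.Dart, (rot d).fst = d.fst
  sameCycle : ∀ d e : G.Dart, d.fst = e.fst → rot.SameCycle d e

/-- Face tracing: traverse the dart `d`, then leave its terminal vertex along the dart that follows
the reversed dart `d.symm` in the rotation there. -/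
def RotationSystem.facePerm {V : Type*} {G : SimpleGraph V} (R : RotationSystem G) :
    Equiv.Perm G.Dart :=
  (Function.Involutive.toPerm SimpleGraph.Dart.symm SimpleGraph.Dart.symm_involutive).trans R.rot

/-- The faces (regions) of the embedding, every connected component of `G` being embedded in a
surface of its own.  The faces of a component with an edge are the cycles of `facePerm`; a component
that is an isolated vertex lies on a sphere of its own, and has one face. -/
def RotationSystem.Face {V : Type*} {G : SimpleGraph V} (R : RotationSystem G) : Type _ :=
  Quotient (Equiv.Perm.SameCycle.setoid R.facePerm) ⊕ {v : V // ∀ w, ¬ G.Adj v w}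

/-- Euler's formula `|V| - |E| + |F| = 2c - 2γ`, where `c` is the number of connected components and
`γ` is the total genus (the sum of the genera of the surfaces that carry the components). -/
def RotationSystem.HasGenus {V : Type*} [Finite V] {G : SimpleGraph V} (R : RotationSystem G)
    (γ : ℕ) : Prop :=
  (Nat.card V : ℤ) - (Nat.card G.edgeSet : ℤ) + (Nat.card R.Face : ℤ) =
    2 * (Nat.card G.ConnectedComponent : ℤ) - 2 * (γ : ℤ)

/-- `G` embeds in the closed orientable surface `S_k`, the sphere with `k` handles: it has a
rotation system of total genus at most `k`. -/
def EmbedsInSurface {V : Type*} [Finite V] (G : SimpleGraph V) (k : ℕ) : Prop :=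
  ∃ (R : RotationSystem G) (γ : ℕ), R.HasGenus γ ∧ γ ≤ k

/-- `G` is planar: it embeds in the sphere. -/
def IsPlanarGraph {V : Type*} [Finite V] (G : SimpleGraph V) : Prop :=
  EmbedsInSurface G 0

/-- `G` is toroidal: it embeds in the torus (planar graphs are toroidal as well). -/
def IsToroidalGraph {V : Type*} [Finite V] (G : SimpleGraph V) : Prop :=
  EmbedsInSurface G 1

/-- The pair of `G` and its complement is PT12: they decompose the complete graph on 12 vertices,
`G` is planar and its complement is toroidal. -/
def IsPT12 {V : Type*} [Finite V] (G : SimpleGraph V) : Prop :=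
  Nat.card V = 12 ∧ IsPlanarGraph G ∧ IsToroidalGraph Gᶜ

/-- Deleting the vertex set `S` from `G` leaves the two parts `A` and `B`: they partition the
remaining vertices and no edge of `G` joins them.  The parts need not induce connected subgraphs.
If `A` and `B` are nonempty, then `S` is a separating set. -/
def DeletionLeaves {V : Type*} (G : SimpleGraph V) (S A B : Set V) : Prop :=
  A ∪ B = Sᶜ ∧ Disjoint A B ∧ ∀ a ∈ A, ∀ b ∈ B, ¬ G.Adj a b

/-! On twelve vertices a planar graph has at most 30 edges and a toroidal one at most 36. As 30 + 36
= 66 is the size of K₁₂, `G` triangulates the sphere and its complement `H` triangulates the torus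
with 36 edges.

Suppose that deleting the 4-cycle c d c' d' leaves A and B. Then `H` contains all 16 edges between A
and B, and on the cycle at most cc' and dd'. A triangle has at most two edges in a cut, so a cut of
`H` has at most 24 edges. With A and B on opposite sides, each of the pairs c, c' and d, d' can be
coloured so that it adds at least 4 edges; hence neither ever adds more than 4. This limits the
`H`-edges from the pairs to A and to B, and so forces `G`-edges (`degIn_le_two`,
`card_union_le_two`).

If cc' is an edge of `H` (dd' is symmetric), then c and c' have common `G`-neighbours a in A and b
in B. No `G`-edge joins A to B, so each arc of the link of c between a and b contains d or d': the
quadrilateral c a c' b separates d from d'. But d and d' are `G`-adjacent or have a common neighbour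
in A other than a (`false_of_quadrilateral`).

Otherwise the cycle spans a K₄ in `G`, which cuts the sphere into four regions. A and B occupy two
regions each, with two vertices in each (`structure_of_clique`). Then in `H` each vertex of A or B
has two neighbours in its own part and each cycle vertex has degree at least 4, so the degree sum is
at least 80 instead of 72 (`false_of_degIn`).

The sphere enters only through homology: by Euler's formula each cycle modulo two bounds a
two-colouring of the faces (`exists_face_colouring`). -/

namespace RotationSystem

/-! ### Short faces and the Euler bound on the number of edges -/

variable {V : Type*} {G : SimpleGraph V} (R : RotationSystem G)

theorem facePerm_apply (d : G.Dart) : R.facePerm d = R.rot d.symm := rfl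

theorem facePerm_fst (d : G.Dart) : (R.facePerm d).fst = d.snd := R.fst_rot d.symm

theorem facePerm_ne (d : G.Dart) : R.facePerm d ≠ d := fun h =>
  d.fst_ne_snd ((congrArg (fun e : G.Dart => e.fst) h).symm.trans (R.facePerm_fst d))

theorem facePerm_snd_of_digon {d : G.Dart} (h : R.facePerm (R.facePerm d) = d) :
    R.facePerm d = d.symm := by
  apply SimpleGraph.Dart.ext
  refine Prod.ext (R.facePerm_fst d) ?_
  rw [← R.facePerm_fst (R.facePerm d), h]
  rfl

theorem rot_eq_self_of_digon {d : G.Dart} (h : R.facePerm (R.facePerm d) = d) : R.rot d = d := by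
  have h' := R.facePerm_snd_of_digon h
  rw [h', facePerm_apply, SimpleGraph.Dart.symm_symm] at h
  exact h

theorem rot_symm_eq_self_of_digon {d : G.Dart} (h : R.facePerm (R.facePerm d) = d) :
    R.rot d.symm = d.symm := R.facePerm_snd_of_digon h

theorem eq_of_rot_eq_self {d e : G.Dart} (h : R.rot d = d) (he : d.fst = e.fst) : d = e :=
  (R.sameCycle d e he).eq_of_left h

theorem eq_or_eq_symm_of_digon {d e : G.Dart} (h : R.facePerm (R.facePerm d) = d)
    (he : e.fst = d.fst ∨ e.fst = d.snd) : e = d ∨ e = d.symm := by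
  rcases he with he | he
  · exact Or.inl (R.eq_of_rot_eq_self (R.rot_eq_self_of_digon h) he.symm).symm
  · exact Or.inr (R.eq_of_rot_eq_self (R.rot_symm_eq_self_of_digon h) he.symm).symm

/-- A digon makes `rot` fix both of its darts, so both ends have degree one and the component is a
single edge. -/
theorem eq_or_eq_of_reachable_of_digon {d : G.Dart} (h : R.facePerm (R.facePerm d) = d) {w : V}
    (hw : G.Reachable d.fst w) : w = d.fst ∨ w = d.snd := by
  rw [SimpleGraph.reachable_iff_reflTransGen] at hw
  induction hw with
  | refl => exact Or.inl rfl
  | tail _ hadj ih =>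
    rename_i b c _
    have := R.eq_or_eq_symm_of_digon h (e := ⟨(b, c), hadj⟩) ih
    rcases this with e | e
    · exact Or.inr (congrArg (fun e : G.Dart => e.snd) e)
    · exact Or.inl (congrArg (fun e : G.Dart => e.snd) e)

/-- The faces of the components with an edge. -/
abbrev Orbit : Type _ := Quotient (Equiv.Perm.SameCycle.setoid R.facePerm)

/-- The orbit of a dart under face tracing. -/
def orbit (d : G.Dart) : R.Orbit := Quotient.mk _ d

theorem orbit_eq {d e : G.Dart} : R.orbit d = R.orbit e ↔ R.facePerm.SameCycle d e :=
  Quotient.eq (r := Equiv.Perm.SameCycle.setoid R.facePerm)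

theorem orbit_facePerm (d : G.Dart) : R.orbit (R.facePerm d) = R.orbit d :=
  R.orbit_eq.2 (Equiv.Perm.sameCycle_apply_left.2 (Equiv.Perm.SameCycle.refl _ _))

theorem exists_orbit (q : R.Orbit) : ∃ d, R.orbit d = q := Quotient.exists_rep q

/-- An orbit that is a digon. -/
def IsDigon (q : R.Orbit) : Prop := ∃ d, R.orbit d = q ∧ R.facePerm (R.facePerm d) = d

/-- The component of an isolated vertex or of a digonal face. -/
noncomputable def smallComponent :
    {v : V // ∀ w, ¬ G.Adj v w} ⊕ {q : R.Orbit // R.IsDigon q} → G.ConnectedComponent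
  | Sum.inl v => G.connectedComponentMk v.1
  | Sum.inr q => G.connectedComponentMk q.2.choose.fst

theorem eq_of_isolated_of_reachable {v w : V} (hv : ∀ w, ¬ G.Adj v w) (h : G.Reachable v w) :
    w = v := by
  rw [SimpleGraph.reachable_iff_reflTransGen] at h
  induction h with
  | refl => rfl
  | tail _ hadj ih => subst ih; exact absurd hadj (hv _)

/-- Isolated vertices and digons are the exceptions to the count of three darts per face. Each uses
up a component of its own, which pays for it in Euler's formula. -/
theorem smallComponent_injective : Function.Injective R.smallComponent := by
  rintro (⟨v, hv⟩ | ⟨q, hq⟩) (⟨w, hw⟩ | ⟨r, hr⟩) h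
  · have := eq_of_isolated_of_reachable hv (SimpleGraph.ConnectedComponent.exact h)
    subst this; rfl
  · have := eq_of_isolated_of_reachable hv (SimpleGraph.ConnectedComponent.exact h)
    exact absurd hr.choose.adj (by rw [this]; exact hv _)
  · have := eq_of_isolated_of_reachable hw (SimpleGraph.ConnectedComponent.exact h.symm)
    exact absurd hq.choose.adj (by rw [this]; exact hw _)
  · have h1 := R.eq_or_eq_of_reachable_of_digon hq.choose_spec.2
      (SimpleGraph.ConnectedComponent.exact h)
    have h2 := R.eq_or_eq_symm_of_digon hq.choose_spec.2 h1
    have : q = r := by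
      rw [← hq.choose_spec.1, ← hr.choose_spec.1]
      rcases h2 with h2 | h2
      · rw [h2]
      · rw [h2, ← R.facePerm_snd_of_digon hq.choose_spec.2, orbit_facePerm]
    subst this; rfl

section Counting

open Classical Finset

variable [Fintype V]

theorem three_le_card_orbit {q : R.Orbit} (hq : ¬ R.IsDigon q) :
    3 ≤ #{d : G.Dart | R.orbit d = q} := by
  obtain ⟨d, rfl⟩ := R.exists_orbit q
  have h1 : R.facePerm (R.facePerm d) ≠ d := fun h => hq ⟨d, rfl, h⟩
  have : #{d, R.facePerm d, R.facePerm (R.facePerm d)} = 3 :=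
    card_eq_three.2 ⟨_, _, _, (R.facePerm_ne d).symm, h1.symm, (R.facePerm_ne _).symm, rfl⟩
  rw [← this]
  apply card_le_card
  intro e he
  simp only [mem_insert, mem_singleton] at he
  rcases he with rfl | rfl | rfl <;> simp [orbit_facePerm]

theorem two_le_card_orbit (q : R.Orbit) : 2 ≤ #{d : G.Dart | R.orbit d = q} := by
  obtain ⟨d, rfl⟩ := R.exists_orbit q
  rw [← card_pair (R.facePerm_ne d).symm]
  apply card_le_card
  intro e he
  simp only [mem_insert, mem_singleton] at he
  rcases he with rfl | rfl <;> simp [orbit_facePerm]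

theorem facePerm_cube_of_card_orbit {d : G.Dart} (hd : ¬ R.IsDigon (R.orbit d))
    (h : #{e : G.Dart | R.orbit e = R.orbit d} = 3) :
    R.facePerm (R.facePerm (R.facePerm d)) = d := by
  have h1 : R.facePerm (R.facePerm d) ≠ d := fun h => hd ⟨d, rfl, h⟩
  have h3 : #{d, R.facePerm d, R.facePerm (R.facePerm d)} = 3 :=
    card_eq_three.2 ⟨_, _, _, (R.facePerm_ne d).symm, h1.symm, (R.facePerm_ne _).symm, rfl⟩
  have h4 : ({d, R.facePerm d, R.facePerm (R.facePerm d)} : Finset G.Dart) =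
      ({e : G.Dart | R.orbit e = R.orbit d} : Finset G.Dart) := by
    apply eq_of_subset_of_card_le _ (by rw [h, h3])
    intro e he
    simp only [mem_insert, mem_singleton] at he
    rcases he with rfl | rfl | rfl <;> simp [orbit_facePerm]
  have h5 : R.facePerm (R.facePerm (R.facePerm d)) ∈
      ({d, R.facePerm d, R.facePerm (R.facePerm d)} : Finset G.Dart) := by
    rw [h4]; simp [orbit_facePerm]
  simp only [mem_insert, mem_singleton] at h5
  rcases h5 with h5 | h5 | h5
  · exact h5
  · exact absurd (R.facePerm.injective h5) h1
  · exact absurd h5 (R.facePerm_ne _)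

theorem three_mul_card_orbit_le :
    3 * Fintype.card R.Orbit ≤ 2 * #G.edgeFinset + Fintype.card {q : R.Orbit // R.IsDigon q} := by
  have h1 : Fintype.card G.Dart = ∑ q : R.Orbit, #{d : G.Dart | R.orbit d = q} := by
    rw [← card_univ]
    exact card_eq_sum_card_fiberwise (fun _ _ => mem_coe.2 (mem_univ _))
  rw [← G.dart_card_eq_twice_card_edges, h1, Fintype.card_subtype, card_filter,
    ← sum_add_distrib, mul_comm, ← card_univ, ← smul_eq_mul, ← sum_const]
  apply sum_le_sum
  intro q _
  by_cases hq : R.IsDigon q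
  · simpa [hq] using R.two_le_card_orbit q
  · simpa [hq] using R.three_le_card_orbit hq

theorem facePerm_cube (hc : IsEmpty {q : R.Orbit // R.IsDigon q})
    (h : 3 * Fintype.card R.Orbit = 2 * #G.edgeFinset) (d : G.Dart) :
    R.facePerm (R.facePerm (R.facePerm d)) = d := by
  have hn : ∀ q, ¬ R.IsDigon q := fun q hq => hc.false ⟨q, hq⟩
  have h1 : Fintype.card G.Dart = ∑ q : R.Orbit, #{d : G.Dart | R.orbit d = q} := by
    rw [← card_univ]
    exact card_eq_sum_card_fiberwise (fun _ _ => mem_coe.2 (mem_univ _))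
  rw [← G.dart_card_eq_twice_card_edges, h1, mul_comm, ← card_univ, ← smul_eq_mul, ← sum_const]
    at h
  rw [sum_eq_sum_iff_of_le (fun q _ => R.three_le_card_orbit (hn q))] at h
  exact R.facePerm_cube_of_card_orbit (hn _) (h _ (mem_univ _)).symm

/-- A graph on at least three vertices with a rotation system of genus `γ` has at most
`3 |V| - 6 + 6 γ` edges; in case of equality it is connected and all faces are triangles. -/
theorem HasGenus.card_edges {R : RotationSystem G} {γ : ℕ} (h : R.HasGenus γ)
    (hV : 3 ≤ Fintype.card V) :
    #G.edgeFinset + 6 ≤ 3 * Fintype.card V + 6 * γ ∧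
    (#G.edgeFinset + 6 = 3 * Fintype.card V + 6 * γ →
      G.Connected ∧ (∀ d, R.facePerm (R.facePerm (R.facePerm d)) = d) ∧
      Fintype.card V + Fintype.card R.Orbit + 2 * γ = #G.edgeFinset + 2) := by
  by_cases hE : #G.edgeFinset = 0
  · exact ⟨by omega, fun _ => by omega⟩
  have h0 : Nat.card R.Face =
      Fintype.card R.Orbit + Fintype.card {v : V // ∀ w, ¬ G.Adj v w} := by
    rw [← Nat.card_eq_fintype_card, ← Nat.card_eq_fintype_card]
    exact Nat.card_sum (α := R.Orbit) (β := {v : V // ∀ w, ¬ G.Adj v w})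
  unfold HasGenus at h
  rw [h0, Nat.card_eq_fintype_card, Nat.card_eq_fintype_card, Nat.card_eq_fintype_card,
    ← Set.toFinset_card] at h
  change (Fintype.card V : ℤ) - (#G.edgeFinset : ℤ) + _ = _ at h
  have h1 := R.three_mul_card_orbit_le
  have h2 := Fintype.card_le_of_injective _ R.smallComponent_injective
  rw [Fintype.card_sum] at h2
  obtain ⟨e, he⟩ := card_pos.1 (Nat.pos_of_ne_zero hE)
  rw [SimpleGraph.mem_edgeFinset] at he
  obtain ⟨x, y, hxy⟩ : ∃ x y, G.Adj x y := by
    induction e with | _ x y => exact ⟨x, y, he⟩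
  -- The component of the edge `x y` contains no isolated vertex.
  have h3 : Fintype.card {v : V // ∀ w, ¬ G.Adj v w} < Fintype.card G.ConnectedComponent := by
    apply Fintype.card_lt_of_injective_of_notMem
      (fun v : {v : V // ∀ w, ¬ G.Adj v w} => G.connectedComponentMk v.1)
      (b := G.connectedComponentMk x)
    · intro v w hvw
      exact Sum.inl_injective (R.smallComponent_injective (a₁ := Sum.inl v) (a₂ := Sum.inl w) hvw)
    · rintro ⟨v, hv⟩
      have := eq_of_isolated_of_reachable v.2 (SimpleGraph.ConnectedComponent.exact hv)
      exact v.2 y (this ▸ hxy)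
  have h4 : Fintype.card G.ConnectedComponent = 1 →
      G.Connected ∧ IsEmpty {q : R.Orbit // R.IsDigon q} := by
    intro hc
    rw [Fintype.card_eq_one_iff] at hc
    obtain ⟨c, hc⟩ := hc
    have hr : ∀ u v, G.Reachable u v := fun u v =>
      SimpleGraph.ConnectedComponent.exact ((hc _).trans (hc _).symm)
    have : Nonempty V := ⟨x⟩
    refine ⟨SimpleGraph.Connected.mk hr, ⟨?_⟩⟩
    rintro ⟨q, d, rfl, hd⟩
    have : (univ : Finset V) ⊆ {d.fst, d.snd} := by
      intro w _
      simpa using R.eq_or_eq_of_reachable_of_digon hd (hr _ w)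
    have := (card_le_card this).trans card_le_two
    rw [card_univ] at this
    omega
  -- With c components, `h2` and `h3` bound the digons plus three times the isolated vertices by 3c
  -- - 2. For c ≥ 2 this makes the edge bound strict, so equality forces c = 1.
  by_cases hc : Fintype.card G.ConnectedComponent = 1
  · obtain ⟨h5, h6⟩ := h4 hc
    have h7 := Fintype.card_eq_zero_iff.2 h6
    refine ⟨by omega, fun heq => ⟨h5, R.facePerm_cube h6 (by omega), by omega⟩⟩
  · exact ⟨by omega, fun heq => by omega⟩

end Counting

end RotationSystem

/-! ### Homology modulo two of a rotation system -/

namespace RotationSystem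

variable {V : Type*} {G : SimpleGraph V} (R : RotationSystem G)

theorem closed_induction [Finite V] {P : G.Dart → Prop} {d e : G.Dart} (hfst : d.fst = e.fst)
    (hd : P d) (hP : ∀ d', d'.fst = d.fst → P d' → P (R.rot d')) : P e := by
  classical
  have := Fintype.ofFinite V
  obtain ⟨n, hn⟩ := (R.sameCycle d e hfst).exists_nat_pow_eq
  have : ∀ n : ℕ, ((R.rot ^ n) d).fst = d.fst ∧ P ((R.rot ^ n) d) := by
    intro n
    induction n with
    | zero => exact ⟨rfl, hd⟩
    | succ n ih =>
      rw [pow_succ', Equiv.Perm.mul_apply]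
      exact ⟨(R.fst_rot _).trans ih.1, hP _ ih.1 ih.2⟩
  exact hn ▸ (this n).2

section Homology

open Classical Finset

/-- The edge underlying a dart. -/
def dartEdge (d : G.Dart) : G.edgeSet := ⟨d.edge, d.edge_mem⟩

theorem dartEdge_eq {d e : G.Dart} : dartEdge d = dartEdge e ↔ d = e ∨ d = e.symm := by
  rw [dartEdge, dartEdge, Subtype.mk.injEq, SimpleGraph.dart_edge_eq_iff]

theorem exists_dartEdge (e : G.edgeSet) : ∃ d, dartEdge d = e := by
  obtain ⟨e, he⟩ := e
  induction e with | _ x y => exact ⟨⟨(x, y), he⟩, rfl⟩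

/-- The boundary of a chain of faces modulo two. -/
noncomputable def faceBoundary : (R.Orbit → ZMod 2) →ₗ[ZMod 2] (G.edgeSet → ZMod 2) where
  toFun κ e := κ (R.orbit (exists_dartEdge e).choose) + κ (R.orbit (exists_dartEdge e).choose.symm)
  map_add' κ l := by ext e; simp; ring
  map_smul' c κ := by ext e; simp; ring

theorem faceBoundary_apply (κ : R.Orbit → ZMod 2) (d : G.Dart) :
    R.faceBoundary κ (dartEdge d) = κ (R.orbit d) + κ (R.orbit d.symm) := by
  change κ (R.orbit (exists_dartEdge (dartEdge d)).choose) +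
    κ (R.orbit (exists_dartEdge (dartEdge d)).choose.symm) = _
  rcases dartEdge_eq.1 (exists_dartEdge (dartEdge d)).choose_spec with h | h
  · rw [h]
  · rw [h, SimpleGraph.Dart.symm_symm, add_comm]

variable [Fintype V]

/-- The boundary of a chain of edges modulo two. -/
noncomputable def edgeBoundary (G : SimpleGraph V) :
    (G.edgeSet → ZMod 2) →ₗ[ZMod 2] (V → ZMod 2) where
  toFun z v := ∑ d : G.Dart with d.fst = v, z (dartEdge d)
  map_add' z w := by ext v; simp [sum_add_distrib]
  map_smul' c z := by ext v; simp [mul_sum]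

/-- The face of `d.symm` is the face of `rot d`, so around a vertex each face value is summed twice.
-/
theorem edgeBoundary_faceBoundary (κ : R.Orbit → ZMod 2) :
    edgeBoundary G (R.faceBoundary κ) = 0 := by
  ext v
  change ∑ d : G.Dart with d.fst = v, R.faceBoundary κ (dartEdge d) = 0
  simp only [faceBoundary_apply, sum_add_distrib]
  have : ∑ d : G.Dart with d.fst = v, κ (R.orbit d.symm) =
      ∑ d : G.Dart with d.fst = v, κ (R.orbit d) := by
    apply sum_equiv R.rot
    · intro d; simp [R.fst_rot]
    · intro d _
      rw [← R.orbit_facePerm d.symm, facePerm_apply, SimpleGraph.Dart.symm_symm]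
  rw [this]
  exact CharTwo.add_self_eq_zero _

theorem edgeBoundary_single (d : G.Dart) :
    edgeBoundary G (Pi.single (dartEdge d) 1) = Pi.single d.fst 1 + Pi.single d.snd 1 := by
  ext v
  have h : ∀ e : G.Dart, (Pi.single (dartEdge d) 1 : G.edgeSet → ZMod 2) (dartEdge e) =
      (if e = d then 1 else 0) + (if e = d.symm then 1 else 0) := by
    intro e
    simp only [Pi.single_apply, dartEdge_eq]
    by_cases h1 : e = d
    · subst h1; simp [(SimpleGraph.Dart.symm_ne e).symm]
    · simp [h1]
  change ∑ e : G.Dart with e.fst = v, (Pi.single (dartEdge d) 1 : G.edgeSet → ZMod 2) _ = _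
  simp only [h, sum_add_distrib, sum_ite_eq', mem_filter, mem_univ, true_and, Pi.add_apply,
    Pi.single_apply, eq_comm (a := v)]
  rfl

/-- Boundaries of edges together with one vertex span all vertex chains, by moving along paths; so
the boundary map has rank at least |V| - 1. -/
theorem finrank_ker_edgeBoundary_le (hG : G.Connected) :
    Module.finrank (ZMod 2) (LinearMap.ker (edgeBoundary G)) + Fintype.card V ≤
      #G.edgeFinset + 1 := by
  obtain ⟨r⟩ := hG.nonempty
  set N := LinearMap.range (edgeBoundary G) ⊔ Submodule.span (ZMod 2) {Pi.single r 1} with hN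
  have h1 : ∀ v, (Pi.single v 1 : V → ZMod 2) ∈ N := by
    intro v
    have hv := hG.preconnected r v
    rw [SimpleGraph.reachable_iff_reflTransGen] at hv
    induction hv with
    | refl => exact Submodule.mem_sup_right (Submodule.mem_span_singleton_self _)
    | tail _ hadj ih =>
      rename_i b c _
      have h2 : (Pi.single b 1 + Pi.single c 1 : V → ZMod 2) ∈ N :=
        Submodule.mem_sup_left ⟨_, edgeBoundary_single ⟨(b, c), hadj⟩⟩
      simpa using N.sub_mem h2 ih
  have h2 : N = ⊤ := by
    rw [eq_top_iff, ← (Pi.basisFun (ZMod 2) V).span_eq, Submodule.span_le]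
    rintro _ ⟨v, rfl⟩
    simpa using h1 v
  have h3 := Submodule.finrank_add_le_finrank_add_finrank (LinearMap.range (edgeBoundary G))
    (Submodule.span (ZMod 2) {(Pi.single r 1 : V → ZMod 2)})
  rw [← hN, h2, finrank_top, Module.finrank_fintype_fun_eq_card] at h3
  have h4 := (edgeBoundary G).finrank_range_add_finrank_ker
  rw [Module.finrank_fintype_fun_eq_card, ← Set.toFinset_card] at h4
  change _ = #G.edgeFinset at h4
  have h5 := finrank_span_le_card (R := ZMod 2) {(Pi.single r 1 : V → ZMod 2)}
  simp only [Set.toFinset_singleton, card_singleton] at h5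
  omega

/-- A chain in the kernel takes equal values on the two sides of each edge, hence around each
vertex, hence everywhere by connectedness. -/
theorem finrank_ker_faceBoundary_le (hG : G.Connected) :
    Module.finrank (ZMod 2) (LinearMap.ker R.faceBoundary) ≤ 1 := by
  have h : LinearMap.ker R.faceBoundary ≤
      Submodule.span (ZMod 2) {(fun _ => 1 : R.Orbit → ZMod 2)} := by
    intro κ hκ
    have h1 : ∀ d, κ (R.orbit d.symm) = κ (R.orbit d) := by
      intro d
      have := congrFun (LinearMap.mem_ker.1 hκ) (dartEdge d)
      rw [faceBoundary_apply] at this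
      exact (CharTwo.add_eq_zero.1 this).symm
    have h2 : ∀ d e : G.Dart, d.fst = e.fst → κ (R.orbit e) = κ (R.orbit d) := by
      intro d e hde
      refine R.closed_induction (P := fun e => κ (R.orbit e) = κ (R.orbit d)) hde rfl ?_
      intro d' _ hd'
      rw [← hd', ← h1 d', ← R.orbit_facePerm d'.symm, facePerm_apply,
        SimpleGraph.Dart.symm_symm]
    rw [Submodule.mem_span_singleton]
    by_cases hd : Nonempty G.Dart
    · obtain ⟨d⟩ := hd
      have h3 : ∀ v, ∀ e : G.Dart, e.fst = v → κ (R.orbit e) = κ (R.orbit d) := by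
        intro v
        have hv := hG.preconnected d.fst v
        rw [SimpleGraph.reachable_iff_reflTransGen] at hv
        induction hv with
        | refl => exact fun e he => h2 d e he.symm
        | tail _ hadj ih =>
          rename_i b c _
          intro e he
          exact (h2 (SimpleGraph.Dart.symm ⟨(b, c), hadj⟩) e he.symm).trans
            ((h1 _).trans (ih _ rfl))
      refine ⟨κ (R.orbit d), ?_⟩
      ext q
      obtain ⟨e, rfl⟩ := R.exists_orbit q
      simpa using (h3 _ e rfl).symm
    · refine ⟨0, ?_⟩
      ext q
      obtain ⟨e, rfl⟩ := R.exists_orbit q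
      exact absurd ⟨e⟩ hd
  exact (Submodule.finrank_mono h).trans ((finrank_span_le_card _).trans (by simp))

/-- On the sphere, every cycle modulo two is the boundary of a chain of faces. -/
theorem exists_face_colouring (hG : G.Connected)
    (hF : Fintype.card V + Fintype.card R.Orbit = #G.edgeFinset + 2) (z : G.Dart → ZMod 2)
    (hz : ∀ d, z d.symm = z d) (hev : ∀ v, ∑ d : G.Dart with d.fst = v, z d = 0) :
    ∃ κ : R.Orbit → ZMod 2, ∀ d, κ (R.orbit d) + κ (R.orbit d.symm) = z d := by
  have h1 := finrank_ker_edgeBoundary_le hG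
  have h2 := R.finrank_ker_faceBoundary_le hG
  have h3 := R.faceBoundary.finrank_range_add_finrank_ker
  rw [Module.finrank_fintype_fun_eq_card] at h3
  have h4 : LinearMap.range R.faceBoundary ≤ LinearMap.ker (edgeBoundary G) := by
    rintro _ ⟨κ, rfl⟩
    exact R.edgeBoundary_faceBoundary κ
  -- The boundaries have dimension at least |F| - 1, which by `hF` equals |E| - |V| + 1, a bound for
  -- the dimension of the cycles.
  have h5 := Submodule.eq_of_le_of_finrank_le h4 (by omega)
  have h6 : ∀ d, z (exists_dartEdge (dartEdge d)).choose = z d := by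
    intro d
    rcases dartEdge_eq.1 (exists_dartEdge (dartEdge d)).choose_spec with h | h
    · rw [h]
    · rw [h, hz]
  have h7 : (fun e => z (exists_dartEdge e).choose) ∈ LinearMap.ker (edgeBoundary G) := by
    rw [LinearMap.mem_ker]
    ext v
    change ∑ d : G.Dart with d.fst = v, z (exists_dartEdge (dartEdge d)).choose = 0
    simp only [h6, hev]
  rw [← h5] at h7
  obtain ⟨κ, hκ⟩ := h7
  refine ⟨κ, fun d => ?_⟩
  rw [← faceBoundary_apply, hκ]
  exact h6 d

end Homology

end RotationSystem

/-! ### Triangulations in terms of neighbours -/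

/-- A triangulation of an oriented closed surface with graph `G`: `nxt v x` is the neighbour of `v`
that follows the neighbour `x` in the rotation at `v`, so that `v`, `x`, `nxt v x` is a face. -/
structure Triangulation {V : Type*} (G : SimpleGraph V) where
  nxt : V → V → V
  adj_nxt : ∀ {v x}, G.Adj v x → G.Adj v (nxt v x)
  adj_link : ∀ {v x}, G.Adj v x → G.Adj x (nxt v x)
  nxt_nxt : ∀ {v x}, G.Adj v x → nxt x (nxt v x) = v
  closed_induction : ∀ {v x y} {P : V → Prop}, G.Adj v x → G.Adj v y → P x →
    (∀ w, G.Adj v w → P w → P (nxt v w)) → P y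

namespace Triangulation

variable {V : Type*} {G : SimpleGraph V} (T : Triangulation G)

theorem nxt_symm {v x : V} (h : G.Adj v x) : T.nxt (T.nxt v x) v = x := by
  have := T.nxt_nxt (T.adj_link h)
  rwa [T.nxt_nxt h] at this

theorem nxt_injOn {v x y : V} (hx : G.Adj v x) (hy : G.Adj v y) (h : T.nxt v x = T.nxt v y) :
    x = y := by
  rw [← T.nxt_symm hx, h, T.nxt_symm hy]

theorem nxt_ne {v x : V} (h : G.Adj v x) : T.nxt v x ≠ x := (T.adj_link h).ne'

/-- The neighbour of `v` that precedes `x`. -/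
def prv (v x : V) : V := T.nxt x v

theorem adj_prv {v x : V} (h : G.Adj v x) : G.Adj v (T.prv v x) := T.adj_link h.symm

theorem nxt_prv {v x : V} (h : G.Adj v x) : T.nxt v (T.prv v x) = x := T.nxt_nxt h.symm

/-- The triangulation is spherical: each cycle modulo two separates the faces.  The value `κ v x` is
the side on which the face `v`, `x`, `nxt v x` lies. -/
def IsSpherical [Fintype V] : Prop :=
  ∀ z : V → V → ZMod 2, (∀ v x, z v x = z x v) → (∀ v x, z v x ≠ 0 → G.Adj v x) →
    (∀ v, ∑ x, z v x = 0) →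
    ∃ κ : V → V → ZMod 2, ∀ v x, G.Adj v x →
      κ x (T.nxt v x) = κ v x ∧ κ v x + κ x v = z v x

end Triangulation

namespace RotationSystem

variable {V : Type*} {G : SimpleGraph V} (R : RotationSystem G)

open Classical in
/-- The neighbour of `v` that follows `x` in the rotation at `v`. -/
noncomputable def nxt (v x : V) : V := if h : G.Adj v x then (R.rot ⟨(v, x), h⟩).snd else x

theorem rot_snd {d : G.Dart} : (R.rot d).snd = R.nxt d.fst d.snd := by
  rw [nxt, dif_pos d.adj]

theorem adj_nxt {v x : V} (h : G.Adj v x) : G.Adj v (R.nxt v x) := by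
  have h1 := (R.rot ⟨(v, x), h⟩).adj
  rwa [R.fst_rot, rot_snd] at h1

theorem rot_mk {v x : V} (h : G.Adj v x) :
    R.rot ⟨(v, x), h⟩ = ⟨(v, R.nxt v x), R.adj_nxt h⟩ :=
  SimpleGraph.Dart.ext _ _ (Prod.ext (R.fst_rot _) R.rot_snd)

theorem facePerm_mk {v x : V} (h : G.Adj x v) :
    R.facePerm ⟨(x, v), h⟩ = ⟨(v, R.nxt v x), R.adj_nxt h.symm⟩ := R.rot_mk h.symm

variable {R}

theorem nxt_of_facePerm_cube (hR : ∀ d, R.facePerm (R.facePerm (R.facePerm d)) = d) {v x : V}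
    (h : G.Adj v x) : G.Adj x (R.nxt v x) ∧ R.nxt x (R.nxt v x) = v := by
  have h0 := hR ⟨(x, v), h.symm⟩
  rw [facePerm_mk, facePerm_mk] at h0
  have h1 := congrArg (fun d : G.Dart => d.fst) h0
  have h2 := congrArg (fun d : G.Dart => d.snd) h0
  rw [facePerm_mk] at h1 h2
  dsimp only at h1 h2
  rw [h1] at h2
  refine ⟨?_, h2⟩
  have := R.adj_nxt (R.adj_nxt h).symm
  rw [h1] at this
  exact this.symm

/-- A rotation system all of whose faces are triangles. -/
noncomputable def triangulation [Finite V]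
    (hR : ∀ d, R.facePerm (R.facePerm (R.facePerm d)) = d) : Triangulation G where
  nxt := R.nxt
  adj_nxt := R.adj_nxt
  adj_link h := (nxt_of_facePerm_cube hR h).1
  nxt_nxt h := (nxt_of_facePerm_cube hR h).2
  closed_induction := by
    intro v x y P hx hy hPx hP
    refine R.closed_induction (P := fun d => P d.snd) (d := ⟨(v, x), hx⟩) (e := ⟨(v, y), hy⟩)
      rfl hPx ?_
    rintro ⟨⟨w, u⟩, hwu⟩ hw hu
    obtain rfl : w = v := hw
    rw [rot_snd]
    exact hP u hwu hu

open Classical Finset in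
theorem triangulation_isSpherical [Fintype V]
    (hR : ∀ d, R.facePerm (R.facePerm (R.facePerm d)) = d) (hG : G.Connected)
    (hF : Fintype.card V + Fintype.card R.Orbit = #G.edgeFinset + 2) :
    (triangulation hR).IsSpherical := by
  intro z hz hsupp hev
  obtain ⟨κ, hκ⟩ := R.exists_face_colouring hG hF (fun d => z d.fst d.snd)
    (fun d => hz _ _) (by
      intro v
      rw [← hev v]
      refine sum_of_injOn (fun d => d.snd) ?_ (fun _ _ => mem_coe.2 (mem_univ _)) ?_ ?_
      · intro d hd e he hde
        simp only [coe_filter, mem_univ, true_and, Set.mem_ofPred_eq] at hd he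
        exact SimpleGraph.Dart.ext _ _ (Prod.ext (hd.trans he.symm) hde)
      · intro x _ hx
        by_contra h
        exact hx ⟨⟨(v, x), hsupp v x h⟩, by simp, rfl⟩
      · intro d hd
        rw [(mem_filter.1 hd).2])
  -- The face `v`, `x`, `nxt v x` is the one traced by the dart from `x` to `v`. The value 0 off the
  -- edges is irrelevant.
  refine ⟨fun v x => if h : G.Adj v x then κ (R.orbit ⟨(x, v), h.symm⟩) else 0, ?_⟩
  intro v x h
  have h1 := (nxt_of_facePerm_cube hR h).1
  have h2 : G.Adj x ((triangulation hR).nxt v x) := h1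
  beta_reduce
  rw [dif_pos h, dif_pos h.symm, dif_pos h2]
  constructor
  · have h3 := R.orbit_facePerm ⟨(x, v), h.symm⟩
    have h4 := R.orbit_facePerm ⟨(v, R.nxt v x), R.adj_nxt h⟩
    rw [facePerm_mk] at h3 h4
    rw [← h3, ← h4]
    congr 4
    exact ((triangulation hR).nxt_symm h).symm
  · rw [add_comm]
    exact hκ ⟨(v, x), h⟩

end RotationSystem

open Finset in
theorem SimpleGraph.natCard_edgeSet {V : Type*} (G : SimpleGraph V) [Fintype G.edgeSet] :
    Nat.card G.edgeSet = #G.edgeFinset := by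
  rw [Nat.card_eq_fintype_card, ← Set.toFinset_card]
  rfl

theorem EmbedsInSurface.card_edges {V : Type*} [Fintype V] {G : SimpleGraph V} {k : ℕ}
    (h : EmbedsInSurface G k) (hV : 3 ≤ Fintype.card V) :
    Nat.card G.edgeSet + 6 ≤ 3 * Fintype.card V + 6 * k ∧
    (Nat.card G.edgeSet + 6 = 3 * Fintype.card V + 6 * k →
      G.Connected ∧ ∃ T : Triangulation G, k = 0 → T.IsSpherical) := by
  classical
  rw [SimpleGraph.natCard_edgeSet]
  obtain ⟨R, γ, hR, hγ⟩ := h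
  obtain ⟨h1, h2⟩ := hR.card_edges hV
  refine ⟨by omega, fun heq => ?_⟩
  -- Equality in the bound for `k`, together with `γ ≤ k`, forces `γ = k`.
  obtain ⟨h3, h4, h5⟩ := h2 (by omega)
  refine ⟨h3, RotationSystem.triangulation h4, fun hk => ?_⟩
  exact RotationSystem.triangulation_isSpherical h4 h3 (by omega)

/-! ### Cuts in a triangulation -/

open Classical Finset in
/-- The number of edges between the two classes of a two-colouring of the vertices. -/
noncomputable def SimpleGraph.cutSize {V : Type*} [Fintype V] (G : SimpleGraph V) (s : V → Bool) :
    ℕ :=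
  ∑ v, ∑ x, if G.Adj v x ∧ s v = true ∧ s x = false then 1 else 0

namespace Triangulation

open Classical Finset

variable {V : Type*} {G : SimpleGraph V} [Fintype V]

theorem sum_rotate (T : Triangulation G) (f : V × V → ℕ) :
    ∑ p : V × V with G.Adj p.1 p.2, f (p.2, T.nxt p.1 p.2) =
      ∑ p : V × V with G.Adj p.1 p.2, f p := by
  refine sum_nbij' (fun p => (p.2, T.nxt p.1 p.2)) (fun p => (T.nxt p.1 p.2, p.1)) ?_ ?_ ?_ ?_ ?_
  · rintro ⟨v, x⟩ h
    simpa using T.adj_link (by simpa using h)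
  · rintro ⟨v, x⟩ h
    simpa using (T.adj_nxt (by simpa using h)).symm
  · rintro ⟨v, x⟩ h
    simp [T.nxt_nxt (show G.Adj v x by simpa using h)]
  · rintro ⟨v, x⟩ h
    simp [T.nxt_symm (show G.Adj v x by simpa using h)]
  · intro p _
    rfl

theorem two_mul_cutSize (s : V → Bool) :
    2 * G.cutSize s = ∑ p : V × V with G.Adj p.1 p.2, if s p.1 = s p.2 then 0 else 1 := by
  rw [two_mul]
  nth_rw 2 [SimpleGraph.cutSize]
  rw [sum_comm, SimpleGraph.cutSize, ← sum_add_distrib, sum_filter, Fintype.sum_prod_type]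
  refine sum_congr rfl fun v _ => ?_
  rw [← sum_add_distrib]
  refine sum_congr rfl fun x _ => ?_
  by_cases h : G.Adj v x
  · cases s v <;> cases s x <;> simp [h, h.symm]
  · simp [h, G.adj_comm x v]

/-- Each cut edge lies on two faces, and each face is counted once for each of its three darts. -/
theorem six_mul_cutSize (T : Triangulation G) (s : V → Bool) :
    6 * G.cutSize s = ∑ p : V × V with G.Adj p.1 p.2,
      ((if s p.1 = s p.2 then 0 else 1) + (if s p.2 = s (T.nxt p.1 p.2) then 0 else 1) +
        (if s (T.nxt p.1 p.2) = s p.1 then 0 else 1)) := by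
  have h1 := two_mul_cutSize (G := G) s
  have h2 := T.sum_rotate (fun p => if s p.1 = s p.2 then 0 else 1)
  have h3 := T.sum_rotate (fun p => if s p.2 = s (T.nxt p.1 p.2) then 0 else 1)
  rw [sum_add_distrib, sum_add_distrib]
  have h4 : ∑ p : V × V with G.Adj p.1 p.2, (if s (T.nxt p.1 p.2) = s p.1 then 0 else 1) =
      ∑ p : V × V with G.Adj p.1 p.2,
        (if s (T.nxt p.1 p.2) = s (T.nxt p.2 (T.nxt p.1 p.2)) then 0 else 1) := by
    refine sum_congr rfl ?_
    rintro ⟨v, x⟩ h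
    rw [T.nxt_nxt (show G.Adj v x by simpa using h)]
  rw [h4]
  simp only at h2 h3
  omega

theorem card_darts : #{p : V × V | G.Adj p.1 p.2} = 2 * Nat.card G.edgeSet := by
  rw [G.natCard_edgeSet, G.two_mul_card_edgeFinset]

/-- A two-coloured triangle has no or two bichromatic edges. -/
theorem three_mul_cutSize_le (T : Triangulation G) (s : V → Bool) : 3 * G.cutSize s ≤ 2 * Nat.card G.edgeSet := by
  have h : 6 * G.cutSize s ≤ #{p : V × V | G.Adj p.1 p.2} * 2 := by
    rw [T.six_mul_cutSize s]
    refine sum_le_card_nsmul _ _ 2 fun p _ => ?_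
    cases s p.1 <;> cases s p.2 <;> cases s (T.nxt p.1 p.2) <;> simp
  rw [card_darts] at h
  omega

theorem three_mul_cutSize_lt (T : Triangulation G) (s : V → Bool) {v x : V} (h : G.Adj v x) (hx : s x = s v)
    (hn : s (T.nxt v x) = s v) : 3 * G.cutSize s < 2 * Nat.card G.edgeSet := by
  have h : 6 * G.cutSize s < #{p : V × V | G.Adj p.1 p.2} * 2 := by
    rw [T.six_mul_cutSize s, ← smul_eq_mul, ← sum_const]
    refine sum_lt_sum (fun p _ => ?_) ⟨(v, x), by simpa using h, by simp [hx, hn]⟩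
    cases s p.1 <;> cases s p.2 <;> cases s (T.nxt p.1 p.2) <;> simp
  rw [card_darts] at h
  omega

end Triangulation

/-! ### Degrees and cuts of the toroidal complement -/

/-- The vertices of `H` are split in two sets `A` and `B` of order four that are completely joined
to each other, and four further vertices, among which `H` has at most the edges `c c'` and
`d d'`. -/
structure IsSplit {V : Type*} (H : SimpleGraph V) (A B : Finset V) (c c' d d' : V) : Prop where
  cover : ∀ v, v ∈ A ∨ v ∈ B ∨ v = c ∨ v = c' ∨ v = d ∨ v = d'
  disj : Disjoint A B
  nodup : [c, c', d, d'].Nodup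
  notMem : ∀ v ∈ [c, c', d, d'], v ∉ A ∧ v ∉ B
  adj : ∀ a ∈ A, ∀ b ∈ B, H.Adj a b
  not_adj : ¬ H.Adj c d ∧ ¬ H.Adj c d' ∧ ¬ H.Adj c' d ∧ ¬ H.Adj c' d'
  cardA : A.card = 4
  cardB : B.card = 4

namespace IsSplit

open Classical Finset

variable {V : Type*} {H : SimpleGraph V} {A B : Finset V} {c c' d d' : V}

theorem swap_sides (h : IsSplit H A B c c' d d') : IsSplit H B A c c' d d' where
  cover v := by have := h.cover v; tauto
  disj := h.disj.symm
  nodup := h.nodup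
  notMem v hv := (h.notMem v hv).symm
  adj b hb a ha := (h.adj a ha b hb).symm
  not_adj := h.not_adj
  cardA := h.cardB
  cardB := h.cardA

theorem swap_left (h : IsSplit H A B c c' d d') : IsSplit H A B c' c d d' where
  cover v := by have := h.cover v; tauto
  disj := h.disj
  nodup := by have := h.nodup; simp only [List.nodup_cons, List.mem_cons] at this ⊢; grind
  notMem v hv := h.notMem v (by simp only [List.mem_cons] at hv ⊢; tauto)
  adj := h.adj
  not_adj := by have := h.not_adj; tauto
  cardA := h.cardA
  cardB := h.cardB

theorem swap_pairs (h : IsSplit H A B c c' d d') : IsSplit H A B d d' c c' where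
  cover v := by have := h.cover v; tauto
  disj := h.disj
  nodup := by have := h.nodup; simp only [List.nodup_cons, List.mem_cons] at this ⊢; grind
  notMem v hv := h.notMem v (by simp only [List.mem_cons] at hv ⊢; tauto)
  adj := h.adj
  not_adj := by
    obtain ⟨h1, h2, h3, h4⟩ := h.not_adj
    exact ⟨fun h => h1 h.symm, fun h => h3 h.symm, fun h => h2 h.symm, fun h => h4 h.symm⟩
  cardA := h.cardA
  cardB := h.cardB

theorem sum_eq [Fintype V] (h : IsSplit H A B c c' d d') (f : V → ℕ) :
    ∑ v, f v = ∑ v ∈ A, f v + ∑ v ∈ B, f v + (f c + f c' + f d + f d') := by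
  have h1 : (univ : Finset V) = (A ∪ B) ∪ {c, c', d, d'} := by
    ext v
    have := h.cover v
    simp only [mem_univ, mem_union, mem_insert, mem_singleton, true_iff]
    tauto
  have h2 : Disjoint (A ∪ B) {c, c', d, d'} := by
    rw [disjoint_right]
    intro v hv
    have := h.notMem v (by simpa using hv)
    simpa using this
  have h3 := h.nodup
  simp only [List.nodup_cons, List.mem_cons, List.not_mem_nil, or_false, not_or] at h3
  rw [h1, sum_union h2, sum_union h.disj, sum_insert (by simp; tauto), sum_insert (by simp; tauto),
    sum_insert (by simp; tauto), sum_singleton]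
  ring

/-- The number of neighbours of `v` in `S`. -/
noncomputable def _root_.SimpleGraph.degIn (H : SimpleGraph V) (S : Finset V) (v : V) : ℕ :=
  #{x ∈ S | H.Adj v x}

/-- The contribution of the vertices `c` and `c'` to a cut. -/
noncomputable def _root_.SimpleGraph.pairWeight (H : SimpleGraph V) (A B : Finset V) (c c' : V)
    (t t' : Bool) : ℕ :=
  (if t then H.degIn B c else H.degIn A c) + (if t' then H.degIn B c' else H.degIn A c') +
    if H.Adj c c' ∧ t ≠ t' then 1 else 0

/-- The two-colouring with classes `A` and `B` and given colours of the other four vertices. -/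
noncomputable def colouring (A B : Finset V) (c c' d : V) (t t' u u' : Bool) (v : V) : Bool :=
  if v ∈ A then true else if v ∈ B then false else
    if v = c then t else if v = c' then t' else if v = d then u else u'

/-- The 16 edges between `A` and `B` are cut, and the two pairs contribute independently since no
edge joins them. -/
theorem le_cutSize [Fintype V] (h : IsSplit H A B c c' d d') (t t' u u' : Bool) :
    16 + H.pairWeight A B c c' t t' + H.pairWeight A B d d' u u' ≤
      H.cutSize (colouring A B c c' d t t' u u') := by
  have h3 := h.nodup
  simp only [List.nodup_cons, List.mem_cons, List.not_mem_nil, or_false, not_or] at h3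
  set s := colouring A B c c' d t t' u u' with hs
  have hA : ∀ a ∈ A, s a = true := fun a ha => by simp [hs, colouring, ha]
  have hB : ∀ b ∈ B, s b = false := fun b hb => by
    simp [hs, colouring, hb, disjoint_right.1 h.disj hb]
  have hc := h.notMem c (by simp)
  have hc' := h.notMem c' (by simp)
  have hd := h.notMem d (by simp)
  have hd' := h.notMem d' (by simp)
  have sc : s c = t := by simp [hs, colouring, hc]
  have sc' : s c' = t' := by simp [hs, colouring, hc', Ne.symm h3.1.1]
  have sd : s d = u := by simp [hs, colouring, hd, Ne.symm h3.1.2.1, Ne.symm h3.2.1.1]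
  have sd' : s d' = u' := by
    simp [hs, colouring, hd', Ne.symm h3.1.2.2, Ne.symm h3.2.1.2, Ne.symm h3.2.2.1]
  have e1 : ∑ a ∈ A, (if s a then H.degIn B a else 0) = 16 := by
    have : ∀ a ∈ A, (if s a then H.degIn B a else 0) = 4 := by
      intro a ha
      rw [if_pos (hA a ha), SimpleGraph.degIn, filter_true_of_mem fun b hb => h.adj a ha b hb,
        h.cardB]
    rw [sum_congr rfl this, sum_const, h.cardA]
    rfl
  have e2 : ∀ x, ∑ a ∈ A, (if H.Adj a x ∧ s a = true ∧ s x = false then 1 else 0) =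
      if s x then 0 else H.degIn A x := by
    intro x
    rw [SimpleGraph.degIn, card_filter]
    cases hx : s x
    · exact sum_congr rfl fun a ha => by simp [hA a ha, H.adj_comm]
    · simp
  have e3 : ∀ x, ∑ b ∈ B, (if H.Adj x b ∧ s x = true ∧ s b = false then 1 else 0) =
      if s x then H.degIn B x else 0 := by
    intro x
    rw [SimpleGraph.degIn, card_filter]
    cases hx : s x
    · simp
    · exact sum_congr rfl fun b hb => by simp [hB b hb]
  rw [SimpleGraph.cutSize, h.sum_eq]
  simp only [h.sum_eq, sum_add_distrib, e1, e2, e3]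
  simp only [sc, sc', sd, sd', SimpleGraph.pairWeight, H.adj_comm c' c, H.adj_comm d' d]
  cases t <;> cases t' <;> cases u <;> cases u' <;> simp <;> omega

end IsSplit

namespace Triangulation

variable {V : Type*} {G : SimpleGraph V} (T : Triangulation G)

/-- The rotation at `x` then interchanges `v` and `nxt v x`, so there is no room for another
neighbour. -/
theorem eq_or_eq_of_nxt_nxt {v x w : V} (h : G.Adj v x) (h2 : T.nxt v (T.nxt v x) = x)
    (hw : G.Adj x w) : w = v ∨ w = T.nxt v x := by
  refine T.closed_induction (P := fun w => w = v ∨ w = T.nxt v x) h.symm hw (Or.inl rfl) ?_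
  rintro u hu (rfl | rfl)
  · have := T.nxt_symm (T.adj_nxt h)
    rw [h2] at this
    exact Or.inr this
  · exact Or.inl (T.nxt_nxt h)

end Triangulation

namespace IsSplit

open Classical Finset

variable {V : Type*} {H : SimpleGraph V} {A B : Finset V} {c c' d d' : V}

theorem mem_of_adj (h : IsSplit H A B c c' d d') {x : V} (hx : H.Adj c x) :
    x ∈ A ∨ x ∈ B ∨ x = c' := by
  rcases h.cover x with h1 | h1 | rfl | h1 | rfl | rfl
  · exact Or.inl h1
  · exact Or.inr (Or.inl h1)
  · exact absurd hx (H.loopless.irrefl _)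
  · exact Or.inr (Or.inr h1)
  · exact absurd hx h.not_adj.1
  · exact absurd hx h.not_adj.2.1

theorem nxt_mem (h : IsSplit H A B c c' d d') (T : Triangulation H) (hcc : H.Adj c c') :
    T.nxt c c' ∈ A ∨ T.nxt c c' ∈ B := by
  rcases h.mem_of_adj (T.adj_nxt hcc) with h1 | h1 | h1
  · exact Or.inl h1
  · exact Or.inr h1
  · exact absurd h1 (T.nxt_ne hcc)

variable [Fintype V]

theorem four_le_degree (h : IsSplit H A B c c' d d') {x : V} (hx : x ∈ A ∨ x ∈ B) :
    4 ≤ #{y | H.Adj x y} := by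
  rcases hx with hx | hx
  · rw [← h.cardB]
    exact card_le_card fun b hb => by simpa using h.adj x hx b hb
  · rw [← h.cardA]
    exact card_le_card fun a ha => by simpa using (h.adj a ha x hx).symm

theorem degree_eq (h : IsSplit H A B c c' d d') :
    #{y | H.Adj c y} = H.degIn A c + H.degIn B c + if H.Adj c c' then 1 else 0 := by
  rw [card_filter, h.sum_eq, SimpleGraph.degIn, SimpleGraph.degIn, card_filter, card_filter]
  simp [h.not_adj.1, h.not_adj.2.1]

/-- A rotation of length two at `c` would leave both neighbours with degree at most two. Vertices of
`A` and `B` have degree at least four, so both would have to be `c'`. -/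
theorem nxt_nxt_ne (h : IsSplit H A B c c' d d') (T : Triangulation H) {x : V} (hx : H.Adj c x) :
    T.nxt c (T.nxt c x) ≠ x := by
  have key : ∀ x, H.Adj c x → T.nxt c (T.nxt c x) = x → ¬ (x ∈ A ∨ x ∈ B) := by
    intro x hx h2 hAB
    have h3 : ({y | H.Adj x y} : Finset V) ⊆ {c, T.nxt c x} := by
      intro w hw
      simpa using T.eq_or_eq_of_nxt_nxt hx h2 (by simpa using hw)
    have := (h.four_le_degree hAB).trans ((card_le_card h3).trans card_le_two)
    omega
  intro h2
  have h3 := key x hx h2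
  have h4 := key _ (T.adj_nxt hx) (by rw [h2])
  have h5 := h.mem_of_adj hx
  have h6 := h.mem_of_adj (T.adj_nxt hx)
  have : x = T.nxt c x := by
    rw [show x = c' by tauto]
    rw [show x = c' by tauto] at h4 h6
    exact (show T.nxt c c' = c' by tauto).symm
  exact T.nxt_ne hx this.symm

theorem three_le_degree (h : IsSplit H A B c c' d d') (T : Triangulation H) (hH : H.Connected) :
    3 ≤ H.degIn A c + H.degIn B c + if H.Adj c c' then 1 else 0 := by
  rw [← h.degree_eq]
  have h3 := h.nodup
  simp only [List.nodup_cons, List.mem_cons, List.not_mem_nil, or_false, not_or] at h3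
  have : Nontrivial V := ⟨c, c', h3.1.1⟩
  obtain ⟨x, hx⟩ := hH.preconnected.exists_adj_of_nontrivial c
  have : #{x, T.nxt c x, T.nxt c (T.nxt c x)} = 3 :=
    card_eq_three.2 ⟨_, _, _, (T.nxt_ne hx).symm, (h.nxt_nxt_ne T hx).symm,
      (T.nxt_ne (T.adj_nxt hx)).symm, rfl⟩
  rw [← this]
  apply card_le_card
  intro y hy
  simp only [mem_insert, mem_singleton] at hy
  rcases hy with rfl | rfl | rfl
  · simpa using hx
  · simpa using T.adj_nxt hx
  · simpa using T.adj_nxt (T.adj_nxt hx)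

theorem nxt_ne_nxt (h : IsSplit H A B c c' d d') (T : Triangulation H) (hcc : H.Adj c c') :
    T.nxt c c' ≠ T.nxt c' c := by
  intro h1
  refine h.nxt_nxt_ne T hcc ?_
  rw [h1]
  exact T.nxt_nxt hcc.symm

theorem nxt_nxt_eq_of_degree_eq_three (h : IsSplit H A B c c' d d') (T : Triangulation H)
    (hcc : H.Adj c c') (hdeg : H.degIn A c + H.degIn B c = 2) :
    T.nxt c (T.nxt c c') = T.nxt c' c := by
  have h1 : #{c', T.nxt c c', T.nxt c' c} = 3 :=
    card_eq_three.2 ⟨_, _, _, (T.nxt_ne hcc).symm, (T.adj_nxt hcc.symm).ne,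
      h.nxt_ne_nxt T hcc, rfl⟩
  have h2 : ({c', T.nxt c c', T.nxt c' c} : Finset V) = ({y | H.Adj c y} : Finset V) := by
    apply eq_of_subset_of_card_le _ (by rw [h.degree_eq, h1, hdeg, if_pos hcc])
    intro y hy
    simp only [mem_insert, mem_singleton] at hy
    rcases hy with rfl | rfl | rfl
    · simpa using hcc
    · simpa using T.adj_nxt hcc
    · simpa using T.adj_link hcc.symm
  have h3 : T.nxt c (T.nxt c c') ∈ ({c', T.nxt c c', T.nxt c' c} : Finset V) := by
    rw [h2]; simpa using T.adj_nxt (T.adj_nxt hcc)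
  simp only [mem_insert, mem_singleton] at h3
  rcases h3 with h3 | h3 | h3
  · exact absurd h3 (h.nxt_nxt_ne T hcc)
  · exact absurd h3 (T.nxt_ne (T.adj_nxt hcc))
  · exact h3

/-- Were both `c` and `c'` of degree three, the third vertex of one face at their edge would be
adjacent only to `c`, `c'` and the third vertex of the other face, but it has degree at least four.
-/
theorem five_le_of_adj (h : IsSplit H A B c c' d d') (T : Triangulation H) (hH : H.Connected)
    (hcc : H.Adj c c') : 5 ≤ H.degIn A c + H.degIn B c + (H.degIn A c' + H.degIn B c') := by
  have h1 := h.three_le_degree T hH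
  have h2 := h.swap_left.three_le_degree T hH
  rw [if_pos hcc] at h1
  rw [if_pos hcc.symm] at h2
  by_contra hlt
  have e1 := h.nxt_nxt_eq_of_degree_eq_three T hcc (by omega)
  have e2 := h.swap_left.nxt_nxt_eq_of_degree_eq_three T hcc.symm (by omega)
  have h3 : ({y | H.Adj (T.nxt c c') y} : Finset V) ⊆ {c, c', T.nxt c' c} := by
    intro y hy
    simp only [mem_filter, mem_univ, true_and, mem_insert, mem_singleton] at hy ⊢
    refine T.closed_induction (P := fun y => y = c ∨ y = c' ∨ y = T.nxt c' c)
      (T.adj_nxt hcc).symm hy (Or.inl rfl) ?_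
    rintro u hu (rfl | rfl | rfl)
    · exact Or.inr (Or.inl (T.nxt_symm hcc))
    · have := T.nxt_symm (T.adj_nxt hcc.symm)
      rw [e2] at this
      exact Or.inr (Or.inr this)
    · have := T.nxt_nxt (T.adj_nxt hcc)
      rw [e1] at this
      exact Or.inl this
  have := (h.four_le_degree (h.nxt_mem T hcc)).trans ((card_le_card h3).trans card_le_three)
  omega

/-- If `c` and `c'` are not adjacent, each sends at least two edges to one of `A` and `B`. If they
are, the two colourings with `t ≠ t'` have total weight at least 5 + 2. -/
theorem exists_four_le_pairWeight (h : IsSplit H A B c c' d d') (T : Triangulation H)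
    (hH : H.Connected) : ∃ t t', 4 ≤ H.pairWeight A B c c' t t' := by
  have h1 := h.three_le_degree T hH
  have h2 := h.swap_left.three_le_degree T hH
  by_contra! hlt
  have w1 := hlt true true
  have w2 := hlt true false
  have w3 := hlt false true
  have w4 := hlt false false
  simp only [SimpleGraph.pairWeight] at w1 w2 w3 w4
  by_cases hcc : H.Adj c c'
  · have h3 := h.five_le_of_adj T hH hcc
    simp [hcc, hcc.symm] at *
    omega
  · have hcc' : ¬ H.Adj c' c := fun h => hcc h.symm
    simp [hcc, hcc'] at *
    omega

/-- The other pair can be coloured to add 4, and 24 - 16 - 4 = 4 is left. -/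
theorem pairWeight_le (h : IsSplit H A B c c' d d') (T : Triangulation H) (hH : H.Connected)
    (hE : Nat.card H.edgeSet = 36) (t t' : Bool) : H.pairWeight A B c c' t t' ≤ 4 := by
  obtain ⟨u, u', hu⟩ := h.swap_pairs.exists_four_le_pairWeight T hH
  have h1 := h.le_cutSize t t' u u'
  have h2 := T.three_mul_cutSize_le (colouring A B c c' d t t' u u')
  omega

/-- Here the face `c`, `c'`, `nxt c c'` is monochromatic, so the cut has fewer than 24 edges. -/
theorem pairWeight_le_of_nxt_mem (h : IsSplit H A B c c' d d') (T : Triangulation H)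
    (hH : H.Connected) (hE : Nat.card H.edgeSet = 36) (hcc : H.Adj c c') (hB : T.nxt c c' ∈ B) :
    H.pairWeight A B c c' false false ≤ 3 := by
  obtain ⟨u, u', hu⟩ := h.swap_pairs.exists_four_le_pairWeight T hH
  have h1 := h.le_cutSize false false u u'
  have hc := h.notMem c (by simp)
  have hc' := h.notMem c' (by simp)
  have s1 : colouring A B c c' d false false u u' c = false := by simp [colouring, hc]
  have s2 : colouring A B c c' d false false u u' c' = false := by simp [colouring, hc']
  have s3 : colouring A B c c' d false false u u' (T.nxt c c') = false := by
    simp [colouring, hB, disjoint_right.1 h.disj hB]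
  have h2 := T.three_mul_cutSize_lt (colouring A B c c' d false false u u') hcc
    (by rw [s1, s2]) (by rw [s1, s3])
  omega

/-- Adding the weights of the two colourings in which `c` joins `B` gives 2 `degIn A c` + deg `c'` ≤
8, while deg `c'` ≥ 3. -/
theorem degIn_le_two (h : IsSplit H A B c c' d d') (T : Triangulation H) (hH : H.Connected)
    (hE : Nat.card H.edgeSet = 36) : H.degIn A c ≤ 2 := by
  have h2 := h.swap_left.three_le_degree T hH
  have w1 := h.pairWeight_le T hH hE false false
  have w2 := h.pairWeight_le T hH hE false true
  simp only [SimpleGraph.pairWeight] at w1 w2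
  by_cases hcc : H.Adj c c'
  · simp [hcc, hcc.symm] at *
    omega
  · have hcc' : ¬ H.Adj c' c := fun h => hcc h.symm
    simp [hcc, hcc'] at *
    omega

/-- The two faces at `c c'` supply two different common neighbours. Each one in `A` lowers the union
by one; one in `B` instead allows the sharper weight bound 3. If both are in `B`, the mixed
colourings leave `c` and `c'` at most one neighbour each in `A`. -/
theorem card_union_le_two (h : IsSplit H A B c c' d d') (T : Triangulation H) (hH : H.Connected)
    (hE : Nat.card H.edgeSet = 36) (hcc : H.Adj c c') : #{a ∈ A | H.Adj c a ∨ H.Adj c' a} ≤ 2 := by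
  have hunion : ∀ S : Finset V, #{a ∈ S | H.Adj c a ∨ H.Adj c' a} +
      #{a ∈ S | H.Adj c a ∧ H.Adj c' a} = H.degIn S c + H.degIn S c' := fun S => by
    rw [filter_or, filter_and, card_union_add_card_inter]; rfl
  have hx : ∀ S : Finset V, T.nxt c c' ∈ S → 0 < #{a ∈ S | H.Adj c a ∧ H.Adj c' a} := fun S hS =>
    card_pos.2 ⟨_, mem_filter.2 ⟨hS, T.adj_nxt hcc, T.adj_link hcc⟩⟩
  have hy : ∀ S : Finset V, T.nxt c' c ∈ S → 0 < #{a ∈ S | H.Adj c a ∧ H.Adj c' a} := fun S hS =>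
    card_pos.2 ⟨_, mem_filter.2 ⟨hS, T.adj_link hcc.symm, T.adj_nxt hcc.symm⟩⟩
  have hxy : ∀ S : Finset V, T.nxt c c' ∈ S → T.nxt c' c ∈ S →
      1 < #{a ∈ S | H.Adj c a ∧ H.Adj c' a} := fun S hx hy =>
    one_lt_card.2 ⟨_, mem_filter.2 ⟨hx, T.adj_nxt hcc, T.adj_link hcc⟩, _,
      mem_filter.2 ⟨hy, T.adj_link hcc.symm, T.adj_nxt hcc.symm⟩, h.nxt_ne_nxt T hcc⟩
  have hle : ∀ S : Finset V, #{a ∈ S | H.Adj c a ∧ H.Adj c' a} ≤ H.degIn S c ∧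
      #{a ∈ S | H.Adj c a ∧ H.Adj c' a} ≤ H.degIn S c' := fun S =>
    ⟨card_le_card (monotone_filter_right _ fun _ _ h => h.1),
      card_le_card (monotone_filter_right _ fun _ _ h => h.2)⟩
  have u1 := hunion A
  have l1 := hle B
  have w1 := h.pairWeight_le T hH hE false false
  have w2 := h.pairWeight_le T hH hE false true
  have w3 := h.pairWeight_le T hH hE true false
  have w4 := h.pairWeight_le_of_nxt_mem T hH hE hcc
  have w5 := h.swap_left.pairWeight_le_of_nxt_mem T hH hE hcc.symm
  simp [SimpleGraph.pairWeight, hcc] at w1 w2 w3 w4 w5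
  rcases h.nxt_mem T hcc with hxA | hxB <;> rcases h.swap_left.nxt_mem T hcc.symm with hyA | hyB
  · have := hxy A hxA hyA
    omega
  · have := hx A hxA
    have := w5 hyB
    omega
  · have := hy A hyA
    have := w4 hxB
    omega
  · have := hxy B hxB hyB
    omega

/-- The successors of `a` and `a'` in the rotation at `c` are distinct, and neither is `a` or `a'`
since consecutive neighbours are adjacent. -/
theorem four_le_degree_of_not_adj (h : IsSplit H A B c c' d d') (T : Triangulation H)
    (hH : H.Connected) (hcc : ¬ H.Adj c c') {a a' : V} (haa : a ≠ a')
    (hca : H.Adj c a) (hca' : H.Adj c a') (hn : ¬ H.Adj a a') :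
    4 ≤ H.degIn A c + H.degIn B c := by
  have h1 := h.three_le_degree T hH
  have h2 := h.degree_eq
  rw [if_neg hcc, add_zero] at h1 h2
  by_contra hlt
  have h3 : ({T.nxt c a, T.nxt c a'} : Finset V) ⊆
      (({y | H.Adj c y} : Finset V).erase a).erase a' := by
    intro y hy
    simp only [mem_insert, mem_singleton] at hy
    simp only [mem_erase, mem_filter, mem_univ, true_and]
    rcases hy with rfl | rfl
    · exact ⟨fun e => hn (e ▸ T.adj_link hca), T.nxt_ne hca, T.adj_nxt hca⟩
    · exact ⟨T.nxt_ne hca', fun e => hn (e ▸ T.adj_link hca').symm, T.adj_nxt hca'⟩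
  have h4 := card_le_card h3
  rw [card_pair fun e => haa (T.nxt_injOn hca hca' e),
    card_erase_of_mem (by simp [haa.symm, hca']), card_erase_of_mem (by simp [hca])] at h4
  omega

end IsSplit

/-! ### The separating quadrilateral -/

namespace Triangulation

open Classical Finset

variable {V : Type*} {G : SimpleGraph V} (T : Triangulation G)

/-- The two-colouring `κ` of the faces has the boundary `z` modulo two. -/
def Bounds (κ z : V → V → ZMod 2) : Prop :=
  ∀ v x, G.Adj v x → κ x (T.nxt v x) = κ v x ∧ κ v x + κ x v = z v x

variable {T} {κ z : V → V → ZMod 2}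

theorem Bounds.nxt (h : T.Bounds κ z) {v x : V} (hx : G.Adj v x) :
    κ v (T.nxt v x) = κ v x + z v (T.nxt v x) := by
  have h1 := (h v x hx).1
  have h2 := (h x (T.nxt v x) (T.adj_link hx)).1
  have h3 := (h v _ (T.adj_nxt hx)).2
  rw [T.nxt_nxt hx, h1] at h2
  rw [← h3, ← h2, add_left_comm, CharTwo.add_self_eq_zero, add_zero]

theorem Bounds.swap (h : T.Bounds κ z) {v x : V} (hx : G.Adj v x) (hz : z v x = 0) :
    κ v x = κ x v := by
  have h3 := (h v _ hx).2
  rw [hz] at h3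
  exact CharTwo.add_eq_zero.1 h3

theorem Bounds.const (h : T.Bounds κ z) {v x y : V} (hz : ∀ w, z v w = 0) (hx : G.Adj v x)
    (hy : G.Adj v y) : κ v y = κ v x := by
  refine T.closed_induction (P := fun y => κ v y = κ v x) hx hy rfl fun w hw hwx => ?_
  rw [h.nxt hw, hz, add_zero, hwx]

theorem Bounds.add_const (h : T.Bounds κ z) (t : ZMod 2) :
    T.Bounds (fun v x => κ v x + t) z := by
  intro v x hx
  obtain ⟨h1, h2⟩ := h v x hx
  refine ⟨congrArg (· + t) h1, ?_⟩
  beta_reduce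
  rw [add_add_add_comm, CharTwo.add_self_eq_zero, add_zero, h2]

theorem zmod_two_ne {t : ZMod 2} : t + 1 ≠ t := by revert t; decide

/-- Here `f` is the side seen from `c` and `q` marks the corners `a`, `b`. A walk from `a` around
the link of `c` cannot step from `A` to `B`, so it keeps the side of `a` and stays in `A`, never
reaching `d`. -/
theorem false_of_side_subset {A B : Finset V} {c c' d d' a b : V}
    (hs : IsSplit Gᶜ A B c c' d d') (hcc : ¬ G.Adj c c') {f q : V → ZMod 2}
    (hf : ∀ x, G.Adj c x → f (T.nxt c x) = f x + q (T.nxt c x))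
    (hq : ∀ x, x = a ∨ x = b ∨ q x = 0) (ha : a ∈ A) (hb : b ∈ B) (hca : G.Adj c a)
    (hcd : G.Adj c d) (had : f a ≠ f d) (had' : f a ≠ f d') : False := by
  have hd : d ∈ A ∧ f d = f a := by
    refine T.closed_induction (P := fun x => x ∈ A ∧ f x = f a) hca hcd ⟨ha, rfl⟩ ?_
    rintro w hw ⟨hwA, hwa⟩
    have h1 := T.adj_link hw
    have h2 := hf w hw
    have hB : T.nxt c w ∉ B := fun hB => (hs.adj w hwA _ hB).2 h1
    have h3 : f (T.nxt c w) = f a := by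
      rcases hq (T.nxt c w) with h3 | h3 | h3
      · rw [h3]
      · exact absurd (h3 ▸ hb) hB
      · rw [h2, h3, hwa, add_zero]
    refine ⟨?_, h3⟩
    rcases hs.cover (T.nxt c w) with h4 | h4 | h4 | h4 | h4 | h4
    · exact h4
    · exact absurd h4 hB
    · exact absurd h4 (T.adj_nxt hw).ne'
    · exact absurd (h4 ▸ T.adj_nxt hw) hcc
    · exact absurd (h4 ▸ h3).symm had
    · exact absurd (h4 ▸ h3).symm had'
  exact had hd.2.symm

/-- The quadrilateral `c`, `a`, `c'`, `b` separates `d` from `d'`. -/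
theorem false_of_quadrilateral [Fintype V] (hT : T.IsSpherical) {A B : Finset V}
    {c c' d d' a b : V} (hs : IsSplit Gᶜ A B c c' d d') (hcc : ¬ G.Adj c c') (ha : a ∈ A)
    (hb : b ∈ B) (hca : G.Adj c a) (hca' : G.Adj c' a) (hcb : G.Adj c b) (hcb' : G.Adj c' b)
    (hcd : G.Adj c d) (hcd' : G.Adj c d')
    (hdd : G.Adj d d' ∨ ∃ a' ∈ A, a' ≠ a ∧ G.Adj d a' ∧ G.Adj d' a') : False := by
  have hn := hs.nodup
  simp only [List.nodup_cons, List.mem_cons, List.not_mem_nil, or_false, not_or, ← ne_eq] at hn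
  obtain ⟨⟨ncc', ncd, ncd'⟩, ⟨nc'd, nc'd'⟩, ndd', -⟩ := hn
  have hc := hs.notMem c (by simp)
  have hc' := hs.notMem c' (by simp)
  have hd := hs.notMem d (by simp)
  have hd' := hs.notMem d' (by simp)
  have nab : a ≠ b := fun h => disjoint_left.1 hs.disj ha (h ▸ hb)
  have nca : c ≠ a := hca.ne
  have nca' : c' ≠ a := hca'.ne
  have ncb : c ≠ b := hcb.ne
  have ncb' : c' ≠ b := hcb'.ne
  have nda : d ≠ a := fun h => hd.1 (h ▸ ha)
  have nda' : d' ≠ a := fun h => hd'.1 (h ▸ ha)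
  have ndb : d ≠ b := fun h => hd.2 (h ▸ hb)
  have ndb' : d' ≠ b := fun h => hd'.2 (h ▸ hb)
  -- The edges of the quadrilateral join the support of `p` to that of `q`, so p(v)q(x) + q(v)p(x)
  -- is its indicator.
  set p : V → ZMod 2 := Pi.single c 1 + Pi.single c' 1 with hp
  set q : V → ZMod 2 := Pi.single a 1 + Pi.single b 1 with hq
  have hp0 : ∀ x, x ≠ c → x ≠ c' → p x = 0 := fun x h1 h2 => by simp [hp, h1, h2]
  have hq0 : ∀ x, x ≠ a → x ≠ b → q x = 0 := fun x h1 h2 => by simp [hq, h1, h2]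
  have hpc : p c = 1 := by simp [hp, ncc']
  have hqa : q a = 1 := by simp [hq, nab]
  have hqb : q b = 1 := by simp [hq, nab.symm]
  have hqc : q c = 0 := hq0 c nca ncb
  obtain ⟨κ, hκ⟩ := hT (fun v x => p v * q x + q v * p x) (fun v x => by ring) (by
      intro v x hvx
      by_contra hadj
      apply hvx
      have h1 : p v * q x = 0 := by
        by_cases h1 : (v = c ∨ v = c') ∧ (x = a ∨ x = b)
        · rcases h1 with ⟨rfl | rfl, rfl | rfl⟩ <;> contradiction
        · rcases not_and_or.1 h1 with h1 | h1
          · rw [not_or] at h1; rw [hp0 v h1.1 h1.2, zero_mul]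
          · rw [not_or] at h1; rw [hq0 x h1.1 h1.2, mul_zero]
      have h2 : q v * p x = 0 := by
        by_cases h1 : (x = c ∨ x = c') ∧ (v = a ∨ v = b)
        · rw [G.adj_comm] at hadj
          rcases h1 with ⟨rfl | rfl, rfl | rfl⟩ <;> contradiction
        · rcases not_and_or.1 h1 with h1 | h1
          · rw [not_or] at h1; rw [hp0 x h1.1 h1.2, mul_zero]
          · rw [not_or] at h1; rw [hq0 v h1.1 h1.2, zero_mul]
      rw [h1, h2, add_zero]) (by
      intro v
      have h1 : ∑ x, p x = 0 := by
        simp only [hp, Pi.add_apply, sum_add_distrib, sum_pi_single', mem_univ, if_true]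
        decide
      have h2 : ∑ x, q x = 0 := by
        simp only [hq, Pi.add_apply, sum_add_distrib, sum_pi_single', mem_univ, if_true]
        decide
      rw [sum_add_distrib, ← mul_sum, ← mul_sum, h1, h2, mul_zero, mul_zero, add_zero])
  have hb' : T.Bounds κ (fun v x => p v * q x + q v * p x) := hκ
  have hf : ∀ x, G.Adj c x → κ c (T.nxt c x) = κ c x + q (T.nxt c x) := by
    intro x hx
    rw [hb'.nxt hx]
    simp only [hpc, hqc, one_mul, zero_mul, add_zero]
  have hq' : ∀ x, x = a ∨ x = b ∨ q x = 0 := fun x => by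
    by_cases h1 : x = a
    · exact Or.inl h1
    · by_cases h2 : x = b
      · exact Or.inr (Or.inl h2)
      · exact Or.inr (Or.inr (hq0 x h1 h2))
  have hz : ∀ v, v ≠ a → v ≠ b → v ≠ c → v ≠ c' → ∀ x, p v * q x + q v * p x = 0 := by
    intro v h1 h2 h3 h4 x
    rw [hp0 v h3 h4, hq0 v h1 h2, zero_mul, zero_mul, add_zero]
  have zd := hz d nda ndb ncd.symm nc'd.symm
  have zd' := hz d' nda' ndb' ncd'.symm nc'd'.symm
  -- The path from `d` to `d'`, through `a'` if need be, avoids the quadrilateral.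
  have hside : κ c d = κ c d' := by
    rw [← hb'.swap hcd.symm (zd c), ← hb'.swap hcd'.symm (zd' c)]
    rcases hdd with h | ⟨a', ha', haa, h1, h2⟩
    · rw [hb'.const zd h hcd.symm, hb'.swap h (zd d'), hb'.const zd' h.symm hcd'.symm]
    · have za' := hz a' haa (fun e => disjoint_left.1 hs.disj ha' (e ▸ hb))
        (fun e => hc.1 (e ▸ ha')) (fun e => hc'.1 (e ▸ ha'))
      rw [hb'.const zd h1 hcd.symm, hb'.swap h1 (zd a'), hb'.const za' h2.symm h1.symm,
        ← hb'.swap h2 (zd' a'), hb'.const zd' h2 hcd'.symm]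
  have h1 : κ c a = κ c d := by
    by_contra h
    exact false_of_side_subset hs hcc hf hq' ha hb hca hcd h (hside ▸ h)
  have h2 : κ c b = κ c d := by
    by_contra h
    exact false_of_side_subset hs.swap_sides hcc hf (fun x => or_left_comm.1 (hq' x)) hb ha
      hcb hcd h (hside ▸ h)
  -- Both arcs at `c` now lie on the side of `d`, although the side must change at `a`.
  have h3 : κ c (T.prv c a) = κ c d := by
    refine T.closed_induction (P := fun x => κ c x = κ c d) hcd (T.adj_prv hca) rfl ?_
    intro w hw hwd
    rcases hq' (T.nxt c w) with h3 | h3 | h3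
    · rw [h3, h1]
    · rw [h3, h2]
    · rw [hf w hw, h3, add_zero, hwd]
  have h4 := hf _ (T.adj_prv hca)
  rw [T.nxt_prv hca, h3, hqa, h1] at h4
  exact zmod_two_ne h4.symm

end Triangulation

/-! ### The four regions of a complete subgraph on four vertices -/

namespace Triangulation

open Classical Finset

variable {V : Type*} {G : SimpleGraph V} {T : Triangulation G}

section Link

/-! Three neighbours `S` of a vertex `v` divide its link in three arcs; `f m` is the indicator of
the arc that does not end in `m`. -/

variable {v : V} {S : Finset V} {f : V → V → ZMod 2}

/-- Otherwise both other indicators are 1 at `j` and stay so up to the next vertex `y ≠ j` of `S`,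
where the indicator of `y` does not change and would be 1 at `y` itself. -/
theorem exists_arc_eq_zero (hS : ∀ m ∈ S, G.Adj v m) (h3 : #S = 3)
    (hf : ∀ m ∈ S, ∀ w, G.Adj v w →
      f m (T.nxt v w) = f m w + if T.nxt v w ∈ S ∧ T.nxt v w ≠ m then 1 else 0)
    (h0 : ∀ m ∈ S, f m m = 0) {j : V} (hj : j ∈ S) : ∃ m ∈ S, m ≠ j ∧ f m j = 0 := by
  by_contra! hne
  have h1 : ∀ m ∈ S, m ≠ j → f m j = 1 := fun m hm hmj =>
    (Fin.eq_one_of_ne_zero _ (hne m hm hmj))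
  obtain ⟨k, hk, hkj⟩ : ∃ k ∈ S, k ≠ j := exists_mem_ne (by omega) j
  have h2 : ∀ m ∈ S, m ≠ j → f m k = 1 := by
    refine T.closed_induction (P := fun w => ∀ m ∈ S, m ≠ j → f m w = 1) (hS j hj) (hS k hk) h1 ?_
    intro w hw ih m hm hmj
    by_cases hy : T.nxt v w ∈ S
    · by_cases hyj : T.nxt v w = j
      · rw [hyj]; exact h1 m hm hmj
      · have h4 := hf _ hy w hw
        rw [h0 _ hy, ih _ hy hyj, if_neg (by simp)] at h4
        exact absurd h4 (by decide)
    · rw [hf m hm w hw, ih m hm hmj, if_neg (fun h => hy h.1), add_zero]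
  have := h2 k hk hkj
  rw [h0 k hk] at this
  exact absurd this (by decide)

/-- If all indicators vanish at `j`, meeting a vertex `y` of `S` would turn on all those with `m ≠
y`, against `exists_arc_eq_zero`. So the walk could never return to `j`. -/
theorem exists_arc_eq_one (hS : ∀ m ∈ S, G.Adj v m) (h3 : #S = 3)
    (hf : ∀ m ∈ S, ∀ w, G.Adj v w →
      f m (T.nxt v w) = f m w + if T.nxt v w ∈ S ∧ T.nxt v w ≠ m then 1 else 0)
    (h0 : ∀ m ∈ S, f m m = 0) {j : V} (hj : j ∈ S) : ∃ m ∈ S, f m j = 1 := by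
  by_contra! hne
  have h1 : ∀ m ∈ S, f m j = 0 := fun m hm => by
    have := hne m hm
    revert this
    generalize f m j = t
    revert t
    decide
  have h2 : ∀ w, G.Adj v w → (∀ m ∈ S, f m w = 0) → T.nxt v w ∉ S := by
    intro w hw ih hy
    obtain ⟨m, hm, hmy, h4⟩ := exists_arc_eq_zero hS h3 hf h0 hy
    rw [hf m hm w hw, ih m hm, if_pos ⟨hy, hmy.symm⟩] at h4
    exact absurd h4 (by decide)
  have h4 : ∀ m ∈ S, f m (T.prv v j) = 0 := by
    refine T.closed_induction (P := fun w => ∀ m ∈ S, f m w = 0) (hS j hj)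
      (T.adj_prv (hS j hj)) h1 ?_
    intro w hw ih m hm
    rw [hf m hm w hw, ih m hm, if_neg (fun h => h2 w hw ih h.1), add_zero]
  refine h2 _ (T.adj_prv (hS j hj)) h4 ?_
  rw [T.nxt_prv (hS j hj)]
  exact hj

theorem existsUnique_arc (hS : ∀ m ∈ S, G.Adj v m) (h3 : #S = 3)
    (hf : ∀ m ∈ S, ∀ w, G.Adj v w →
      f m (T.nxt v w) = f m w + if T.nxt v w ∈ S ∧ T.nxt v w ≠ m then 1 else 0)
    (h0 : ∀ m ∈ S, f m m = 0) {x : V} (hx : G.Adj v x) :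
    ∃ m ∈ S, f m x = 1 ∧ ∀ n ∈ S, n ≠ m → f n x = 0 := by
  have hbase : ∀ j ∈ S, ∃ m ∈ S, f m j = 1 ∧ ∀ n ∈ S, n ≠ m → f n j = 0 := by
    intro j hj
    obtain ⟨m, hm, hmj⟩ := exists_arc_eq_one hS h3 hf h0 hj
    obtain ⟨k, hk, hkj, hk0⟩ := exists_arc_eq_zero hS h3 hf h0 hj
    refine ⟨m, hm, hmj, fun n hn hnm => ?_⟩
    have hjm : j ≠ m := fun h => by
      subst h; rw [h0 j hj] at hmj; exact absurd hmj (by decide)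
    have hkm : k ≠ m := fun h => by
      subst h; rw [hk0] at hmj; exact absurd hmj (by decide)
    have h4 : ({j, k, m} : Finset V) = S := eq_of_subset_of_card_le
      (by simp [insert_subset_iff, hj, hk, hm])
      (by rw [h3, card_eq_three.2 ⟨j, k, m, hkj.symm, hjm, hkm, rfl⟩])
    rw [← h4] at hn
    simp only [mem_insert, mem_singleton] at hn
    rcases hn with rfl | rfl | rfl
    · exact h0 _ hj
    · exact hk0
    · exact absurd rfl hnm
  obtain ⟨j, hj⟩ := card_pos.1 (by omega : 0 < #S)
  refine T.closed_induction
    (P := fun x => ∃ m ∈ S, f m x = 1 ∧ ∀ n ∈ S, n ≠ m → f n x = 0) (hS j hj) hx (hbase j hj) ?_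
  rintro w hw ⟨m, hm, h1, h2⟩
  by_cases hy : T.nxt v w ∈ S
  · exact hbase _ hy
  · have h4 : ∀ n ∈ S, f n (T.nxt v w) = f n w := fun n hn => by
      rw [hf n hn w hw, if_neg (fun h => hy h.1), add_zero]
    exact ⟨m, hm, (h4 m hm).trans h1, fun n hn hnm => (h4 n hn).trans (h2 n hn hnm)⟩

/-- Leaving the arc turns `f l` off at a vertex of `S` other than `l`. Two such vertices and `l`
exhaust `S`, and then `f l` is never turned on. -/
theorem arc_end_unique (hS : ∀ m ∈ S, G.Adj v m) (h3 : #S = 3)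
    (hf : ∀ m ∈ S, ∀ w, G.Adj v w →
      f m (T.nxt v w) = f m w + if T.nxt v w ∈ S ∧ T.nxt v w ≠ m then 1 else 0)
    (h0 : ∀ m ∈ S, f m m = 0) {l x y : V} (hl : l ∈ S) (hx : G.Adj v x) (hy : G.Adj v y)
    (hlx : f l x = 1) (hly : f l y = 1) (hxS : T.nxt v x ∈ S) (hyS : T.nxt v y ∈ S) : x = y := by
  have key : ∀ x, G.Adj v x → f l x = 1 → T.nxt v x ∈ S →
      T.nxt v x ≠ l ∧ f l (T.nxt v x) = 0 := by
    intro x hx hlx hxS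
    have h4 := hf l hl x hx
    have hne : T.nxt v x ≠ l := fun h => by
      rw [h, h0 l hl, hlx, if_neg (by simp)] at h4
      exact absurd h4 (by decide)
    rw [hlx, if_pos ⟨hxS, hne⟩] at h4
    exact ⟨hne, h4⟩
  obtain ⟨h1, h2⟩ := key x hx hlx hxS
  obtain ⟨h4, h5⟩ := key y hy hly hyS
  by_contra hxy
  have hne : T.nxt v x ≠ T.nxt v y := fun h => hxy (T.nxt_injOn hx hy h)
  have h6 : ({l, T.nxt v x, T.nxt v y} : Finset V) = S := eq_of_subset_of_card_le
    (by simp [insert_subset_iff, hl, hxS, hyS])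
    (by rw [h3, card_eq_three.2 ⟨_, _, _, h1.symm, h4.symm, hne, rfl⟩])
  have h7 : f l x = 0 := by
    refine T.closed_induction (P := fun w => f l w = 0) (hS l hl) hx (h0 l hl) ?_
    intro w hw hw0
    by_cases hy : T.nxt v w ∈ S
    · rw [← h6] at hy
      simp only [mem_insert, mem_singleton] at hy
      rcases hy with hy | hy | hy <;> rw [hy]
      · exact h0 l hl
      · exact h2
      · exact h5
    · rw [hf l hl w hw, hw0, if_neg (fun h => hy h.1), add_zero]
  rw [h7] at hlx
  exact absurd hlx (by decide)

end Link

/-- A complete subgraph on four vertices divides the sphere in four regions: `Reg l` consists of the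
vertices inside the triangle opposite to `l`. -/
theorem exists_regions [Fintype V] (hT : T.IsSpherical) {C : Finset V} (hC : #C = 4)
    (hclique : ∀ u ∈ C, ∀ v ∈ C, u ≠ v → G.Adj u v) :
    ∃ Reg : V → V → Prop,
      (∀ l ∈ C, ∀ x, x ∉ C → ∀ y, y ∉ C → G.Adj x y → Reg l x → Reg l y) ∧
      (∀ l ∈ C, ∀ x, x ∉ C → G.Adj l x → ¬ Reg l x) ∧
      (∀ c ∈ C, ∀ x, x ∉ C → G.Adj c x →
        ∃ m ∈ C, m ≠ c ∧ Reg m x ∧ ∀ n ∈ C, n ≠ m → ¬ Reg n x) ∧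
      (∀ c ∈ C, ∀ l ∈ C, ∀ x, x ∉ C → ∀ y, y ∉ C → G.Adj c x → G.Adj c y → Reg l x → Reg l y →
        T.nxt c x ∈ C → T.nxt c y ∈ C → x = y) := by
  -- The cycle `z l` is the triangle on `C` without `l`.
  set z : V → V → V → ZMod 2 := fun l v x =>
    if v ∈ C ∧ v ≠ l ∧ x ∈ C ∧ x ≠ l ∧ v ≠ x then 1 else 0 with hz
  have hex : ∀ l ∈ C, ∃ κ, T.Bounds κ (z l) ∧ ∀ y, G.Adj l y → κ l y = 0 := by
    intro l hl
    obtain ⟨κ, hκ⟩ := hT (z l) (fun v x => by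
        simp only [hz]
        congr 1
        simp only [eq_iff_iff, ne_eq, eq_comm (a := v) (b := x)]
        tauto) (fun v x h => by
        have : v ∈ C ∧ v ≠ l ∧ x ∈ C ∧ x ≠ l ∧ v ≠ x := by
          by_contra hn
          exact h (if_neg hn)
        exact hclique v this.1 x this.2.2.1 this.2.2.2.2) (by
        intro v
        by_cases hv : v ∈ C ∧ v ≠ l
        · have h1 : ∀ x, z l v x = if x ∈ (C.erase l).erase v then 1 else 0 := by
            intro x
            simp only [hz, mem_erase]
            congr 1
            simp only [eq_iff_iff, ne_eq, eq_comm (a := v) (b := x)]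
            tauto
          rw [sum_congr rfl fun x _ => h1 x, sum_ite_mem, univ_inter, sum_const,
            card_erase_of_mem (mem_erase.2 ⟨hv.2, hv.1⟩), card_erase_of_mem hl, hC]
          decide
        · exact sum_eq_zero fun x _ => if_neg fun h => hv ⟨h.1, h.2.1⟩)
    obtain ⟨y, hy, hyl⟩ := exists_mem_ne (by omega : 1 < #C) l
    have hb : T.Bounds κ (z l) := hκ
    -- Normalised so that `l` itself lies outside its opposite triangle.
    refine ⟨_, hb.add_const (κ l y), fun x hx => ?_⟩
    rw [hb.const (fun w => by simp [hz]) (hclique l hl y hy hyl.symm) hx]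
    exact CharTwo.add_self_eq_zero _
  choose! κ hκ hκ0 using hex
  have hzx : ∀ l, ∀ x, x ∉ C → ∀ w, z l x w = 0 := fun l x hx w => if_neg fun h => hx h.1
  have hzc : ∀ l, ∀ x, x ∉ C → ∀ w, z l w x = 0 := fun l x hx w => if_neg fun h => hx h.2.2.1
  have hreg : ∀ c ∈ C, ∀ l ∈ C, ∀ x, x ∉ C → G.Adj c x →
      ((∃ y, G.Adj x y ∧ κ l x y = 1) ↔ κ l c x = 1) := by
    intro c hc l hl x hx hcx
    rw [(hκ l hl).swap hcx (hzc l x hx c)]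
    constructor
    · rintro ⟨y, hy, h⟩
      rw [(hκ l hl).const (hzx l x hx) hy hcx.symm, h]
    · exact fun h => ⟨c, hcx.symm, h⟩
  have hS : ∀ c ∈ C, ∀ m ∈ C.erase c, G.Adj c m := fun c hc m hm =>
    hclique c hc m (mem_of_mem_erase hm) (ne_of_mem_erase hm).symm
  have h3 : ∀ c ∈ C, #(C.erase c) = 3 := fun c hc => by rw [card_erase_of_mem hc, hC]
  have hf : ∀ c ∈ C, ∀ m ∈ C.erase c, ∀ w, G.Adj c w → κ m c (T.nxt c w) = κ m c w +
      if T.nxt c w ∈ C.erase c ∧ T.nxt c w ≠ m then 1 else 0 := by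
    intro c hc m hm w hw
    rw [(hκ m (mem_of_mem_erase hm)).nxt hw]
    congr 1
    simp only [hz, mem_erase]
    congr 1
    have h4 := (ne_of_mem_erase hm).symm
    have h5 := (T.adj_nxt hw).ne
    simp only [hc, h4, h5, h5.symm, ne_eq, not_false_eq_true, true_and, and_true]
  have h0 : ∀ c ∈ C, ∀ m ∈ C.erase c, κ m c m = 0 := by
    intro c hc m hm
    rw [(hκ m (mem_of_mem_erase hm)).swap (hS c hc m hm) (by simp [hz])]
    exact hκ0 m (mem_of_mem_erase hm) c (hS c hc m hm).symm
  have hself : ∀ l ∈ C, ∀ x, x ∉ C → G.Adj l x → ¬ ∃ y, G.Adj x y ∧ κ l x y = 1 := by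
    intro l hl x hx hlx h
    rw [hreg l hl l hl x hx hlx, hκ0 l hl x hlx] at h
    exact absurd h (by decide)
  -- Off `C` all faces at `x` have the same value, so one neighbour decides.
  refine ⟨fun l x => ∃ y, G.Adj x y ∧ κ l x y = 1, ?_, hself, ?_, ?_⟩
  · rintro l hl x hx y hy hxy ⟨w, hw, h⟩
    refine ⟨x, hxy.symm, ?_⟩
    rw [← (hκ l hl).swap hxy (hzx l x hx y), (hκ l hl).const (hzx l x hx) hw hxy, h]
  · intro c hc x hx hcx
    obtain ⟨m, hm, h1, h2⟩ := existsUnique_arc (f := fun m x => κ m c x) (hS c hc) (h3 c hc)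
      (hf c hc) (h0 c hc) hcx
    refine ⟨m, mem_of_mem_erase hm, ne_of_mem_erase hm,
      (hreg c hc m (mem_of_mem_erase hm) x hx hcx).2 h1, fun n hn hnm h => ?_⟩
    by_cases hnc : n = c
    · subst hnc; exact hself n hn x hx hcx h
    · have h4 := h2 n (mem_erase.2 ⟨hnc, hn⟩) hnm
      have h5 := (hreg c hc n hn x hx hcx).1 h
      rw [h4] at h5
      exact absurd h5 (by decide)
  · intro c hc l hl x hx y hy hcx hcy hlx hly hxC hyC
    have hlc : l ≠ c := fun h => by subst h; exact hself l hl x hx hcx hlx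
    exact arc_end_unique (f := fun m x => κ m c x) (hS c hc) (h3 c hc) (hf c hc) (h0 c hc)
      (mem_erase.2 ⟨hlc, hl⟩) hcx hcy ((hreg c hc l hl x hx hcx).1 hlx)
      ((hreg c hc l hl y hy hcy).1 hly) (mem_erase.2 ⟨(T.adj_nxt hcx).ne', hxC⟩)
      (mem_erase.2 ⟨(T.adj_nxt hcy).ne', hyC⟩)

end Triangulation

/-! ### Distribution of the two parts over the regions -/

namespace Triangulation

open Classical Finset

variable {V : Type*} {G : SimpleGraph V} {T : Triangulation G}

section Regions

variable {C : Finset V} {Reg : V → V → Prop}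

/-- An arc of the link of `c` that lies in the set `X` ends next to a vertex of `C`. -/
theorem exists_arc_end (hC : 1 < #C) (hclique : ∀ u ∈ C, ∀ v ∈ C, u ≠ v → G.Adj u v)
    (hadj : ∀ l ∈ C, ∀ x, x ∉ C → ∀ y, y ∉ C → G.Adj x y → Reg l x → Reg l y)
    {X : Finset V} (hXC : ∀ x ∈ X, x ∉ C) (hX : ∀ x ∈ X, ∀ y, G.Adj x y → y ∈ X ∨ y ∈ C)
    {c l x : V} (hc : c ∈ C) (hl : l ∈ C) (hx : x ∈ X) (hcx : G.Adj c x) (hlx : Reg l x) :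
    ∃ y ∈ X, G.Adj c y ∧ Reg l y ∧ T.nxt c y ∈ C := by
  by_contra! hne
  obtain ⟨k, hk, hkc⟩ := exists_mem_ne hC c
  have : k ∈ X ∧ Reg l k := by
    refine T.closed_induction (P := fun w => w ∈ X ∧ Reg l w) hcx (hclique c hc k hk hkc.symm)
      ⟨hx, hlx⟩ ?_
    rintro w hw ⟨hwX, hlw⟩
    have h1 := hne w hwX hw hlw
    have h2 := (hX w hwX _ (T.adj_link hw)).resolve_right h1
    exact ⟨h2, hadj l hl w (hXC w hwX) _ h1 (T.adj_link hw) hlw⟩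
  exact hXC k this.1 hk

/-- The end of the arc at `c` is also seen by the next vertex in the link, which is in `C`. -/
theorem one_lt_card_seeing (hC : 1 < #C) (hclique : ∀ u ∈ C, ∀ v ∈ C, u ≠ v → G.Adj u v)
    (T : Triangulation G)
    (hadj : ∀ l ∈ C, ∀ x, x ∉ C → ∀ y, y ∉ C → G.Adj x y → Reg l x → Reg l y)
    {X : Finset V} (hXC : ∀ x ∈ X, x ∉ C) (hX : ∀ x ∈ X, ∀ y, G.Adj x y → y ∈ X ∨ y ∈ C)
    {c l x : V} (hc : c ∈ C) (hl : l ∈ C) (hx : x ∈ X) (hcx : G.Adj c x) (hlx : Reg l x) :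
    1 < #{c ∈ C | ∃ x ∈ X, G.Adj c x ∧ Reg l x} := by
  obtain ⟨y, hy, hcy, hly, hn⟩ :=
    exists_arc_end (T := T) hC hclique hadj hXC hX hc hl hx hcx hlx
  exact one_lt_card.2 ⟨c, mem_filter.2 ⟨hc, x, hx, hcx, hlx⟩, T.nxt c y,
    mem_filter.2 ⟨hn, y, hy, (T.adj_link hcy).symm, hly⟩, (T.adj_nxt hcy).ne⟩

/-- A region that is seen from `C` contains vertices of only one of the two sets. -/
theorem not_seen_both (hC : #C = 4) (hclique : ∀ u ∈ C, ∀ v ∈ C, u ≠ v → G.Adj u v)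
    (T : Triangulation G)
    (hadj : ∀ l ∈ C, ∀ x, x ∉ C → ∀ y, y ∉ C → G.Adj x y → Reg l x → Reg l y)
    (hself : ∀ l ∈ C, ∀ x, x ∉ C → G.Adj l x → ¬ Reg l x)
    (hend : ∀ c ∈ C, ∀ l ∈ C, ∀ x, x ∉ C → ∀ y, y ∉ C → G.Adj c x → G.Adj c y → Reg l x →
      Reg l y → T.nxt c x ∈ C → T.nxt c y ∈ C → x = y)
    {A B : Finset V} (hAB : Disjoint A B)
    (hAC : ∀ x ∈ A, x ∉ C) (hA : ∀ x ∈ A, ∀ y, G.Adj x y → y ∈ A ∨ y ∈ C)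
    (hBC : ∀ x ∈ B, x ∉ C) (hB : ∀ x ∈ B, ∀ y, G.Adj x y → y ∈ B ∨ y ∈ C)
    {l : V} (hl : l ∈ C) (h1 : ∃ c ∈ C, ∃ x ∈ A, G.Adj c x ∧ Reg l x)
    (h2 : ∃ c ∈ C, ∃ x ∈ B, G.Adj c x ∧ Reg l x) : False := by
  obtain ⟨c, hc, x, hx, hcx, hlx⟩ := h1
  obtain ⟨c', hc', x', hx', hcx', hlx'⟩ := h2
  have e1 := one_lt_card_seeing (by omega) hclique T hadj hAC hA hc hl hx hcx hlx
  have e2 := one_lt_card_seeing (by omega) hclique T hadj hBC hB hc' hl hx' hcx' hlx'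
  -- A vertex seeing both parts in one region would have an arc end in each of them, but the end is
  -- unique.
  have e3 : Disjoint ({c ∈ C | ∃ x ∈ A, G.Adj c x ∧ Reg l x} : Finset V)
      {c ∈ C | ∃ x ∈ B, G.Adj c x ∧ Reg l x} := by
    rw [disjoint_left]
    intro c hcA hcB
    obtain ⟨hc, x, hx, hcx, hlx⟩ := mem_filter.1 hcA
    obtain ⟨-, x', hx', hcx', hlx'⟩ := mem_filter.1 hcB
    obtain ⟨y, hy, hcy, hly, hn⟩ :=
      exists_arc_end (T := T) (by omega) hclique hadj hAC hA hc hl hx hcx hlx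
    obtain ⟨y', hy', hcy', hly', hn'⟩ :=
      exists_arc_end (T := T) (by omega) hclique hadj hBC hB hc hl hx' hcx' hlx'
    have := hend c hc l hl y (hAC y hy) y' (hBC y' hy') hcy hcy' hly hly' hn hn'
    exact disjoint_left.1 hAB hy (this ▸ hy')
  -- Only the three vertices other than `l` see the region, too few for two disjoint pairs.
  have e4 : ({c ∈ C | ∃ x ∈ A, G.Adj c x ∧ Reg l x} ∪
      {c ∈ C | ∃ x ∈ B, G.Adj c x ∧ Reg l x} : Finset V) ⊆ C.erase l := by
    intro c hc
    rw [mem_erase]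
    rcases mem_union.1 hc with hc | hc
    · obtain ⟨hc, x, hx, hcx, hlx⟩ := mem_filter.1 hc
      exact ⟨fun h => hself l hl x (hAC x hx) (h ▸ hcx) hlx, hc⟩
    · obtain ⟨hc, x, hx, hcx, hlx⟩ := mem_filter.1 hc
      exact ⟨fun h => hself l hl x (hBC x hx) (h ▸ hcx) hlx, hc⟩
  have e5 := card_le_card e4
  rw [card_union_of_disjoint e3, card_erase_of_mem hl] at e5
  omega

/-- A neighbour of `c` in `X` lies in a region opposite some `m ≠ c`; a neighbour of `m` then yields
a second region. -/
theorem one_lt_card_seen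
    (huniq : ∀ c ∈ C, ∀ x, x ∉ C → G.Adj c x →
      ∃ m ∈ C, m ≠ c ∧ Reg m x ∧ ∀ n ∈ C, n ≠ m → ¬ Reg n x)
    {X : Finset V} (hXC : ∀ x ∈ X, x ∉ C) (hX2 : ∀ c ∈ C, 2 ≤ #{x ∈ X | G.Adj c x})
    (hC : C.Nonempty) : 1 < #{l ∈ C | ∃ c ∈ C, ∃ x ∈ X, G.Adj c x ∧ Reg l x} := by
  have h : ∀ c ∈ C, ∃ m ∈ ({l ∈ C | ∃ c ∈ C, ∃ x ∈ X, G.Adj c x ∧ Reg l x} : Finset V),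
      m ≠ c := by
    intro c hc
    obtain ⟨x, hx⟩ := card_pos.1 (by have := hX2 c hc; omega : 0 < #{x ∈ X | G.Adj c x})
    obtain ⟨hx, hcx⟩ := mem_filter.1 hx
    obtain ⟨m, hm, hmc, hmx, -⟩ := huniq c hc x (hXC x hx) hcx
    exact ⟨m, mem_filter.2 ⟨hm, c, hc, x, hx, hcx, hmx⟩, hmc⟩
  obtain ⟨c, hc⟩ := hC
  obtain ⟨m, hm, -⟩ := h c hc
  obtain ⟨n, hn, hnm⟩ := h m (mem_filter.1 hm).1
  exact one_lt_card.2 ⟨m, hm, n, hn, hnm.symm⟩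

theorem reg_of_seen_eq_pair
    (huniq : ∀ c ∈ C, ∀ x, x ∉ C → G.Adj c x →
      ∃ m ∈ C, m ≠ c ∧ Reg m x ∧ ∀ n ∈ C, n ≠ m → ¬ Reg n x)
    {X : Finset V} (hXC : ∀ x ∈ X, x ∉ C) {l l' : V} (hl : l ∈ C)
    (hX : ({l ∈ C | ∃ c ∈ C, ∃ x ∈ X, G.Adj c x ∧ Reg l x} : Finset V) = {l, l'})
    {x : V} (hx : x ∈ X) (hlx : G.Adj l x) : Reg l' x := by
  obtain ⟨m, hm, hml, hmx, -⟩ := huniq l hl x (hXC x hx) hlx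
  have h : m ∈ ({l ∈ C | ∃ c ∈ C, ∃ x ∈ X, G.Adj c x ∧ Reg l x} : Finset V) :=
    mem_filter.2 ⟨hm, l, hl, x, hx, hlx, hmx⟩
  rw [hX] at h
  simp only [mem_insert, mem_singleton] at h
  rcases h with h | h
  · exact absurd h hml
  · exact h ▸ hmx

/-- The two regions that contain vertices of `X` have two of them each. -/
theorem structure_of_seen (T : Triangulation G)
    (hadj : ∀ l ∈ C, ∀ x, x ∉ C → ∀ y, y ∉ C → G.Adj x y → Reg l x → Reg l y)
    (hself : ∀ l ∈ C, ∀ x, x ∉ C → G.Adj l x → ¬ Reg l x)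
    (hend : ∀ c ∈ C, ∀ l ∈ C, ∀ x, x ∉ C → ∀ y, y ∉ C → G.Adj c x → G.Adj c y → Reg l x →
      Reg l y → T.nxt c x ∈ C → T.nxt c y ∈ C → x = y)
    {X : Finset V} (hX4 : #X = 4) (hX2 : ∀ c ∈ C, 2 ≤ #{x ∈ X | G.Adj c x})
    (hXC : ∀ x ∈ X, x ∉ C) (hX : ∀ x ∈ X, ∀ y, G.Adj x y → y ∈ X ∨ y ∈ C)
    {l l' : V} (hl : l ∈ C) (hl' : l' ∈ C)
    (h1 : ∀ x ∈ X, G.Adj l x → Reg l' x) :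
    (∃ a ∈ X, ∃ a' ∈ X, a ≠ a' ∧ G.Adj a a' ∧ ¬ G.Adj l' a ∧ ¬ G.Adj l' a') ∧
      ∀ a ∈ X, 2 ≤ #{x ∈ X | a ≠ x ∧ ¬ G.Adj a x} := by
  -- Neighbours of `l` lie in the region opposite `l'`, so none is adjacent to `l'`. With at least
  -- two neighbours each, `l` and `l'` split `X` into two pairs.
  have hdisj : Disjoint ({x ∈ X | G.Adj l x} : Finset V) {x ∈ X | G.Adj l' x} := by
    rw [disjoint_left]
    intro x hx hx'
    obtain ⟨hxX, hx⟩ := mem_filter.1 hx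
    exact hself l' hl' x (hXC x hxX) (mem_filter.1 hx').2 (h1 x hxX hx)
  have hsub : ({x ∈ X | G.Adj l x} ∪ {x ∈ X | G.Adj l' x} : Finset V) ⊆ X :=
    union_subset (filter_subset _ _) (filter_subset _ _)
  have hcard := card_le_card hsub
  rw [card_union_of_disjoint hdisj, hX4] at hcard
  have c1 := hX2 l hl
  have c2 := hX2 l' hl'
  have hcover := eq_of_subset_of_card_le hsub (by rw [card_union_of_disjoint hdisj]; omega)
  have hsep : ∀ x ∈ X, G.Adj l x → ∀ y ∈ X, G.Adj l' y → ¬ G.Adj x y := fun x hx hlx y hy hly h =>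
    hself l' hl' y (hXC y hy) hly (hadj l' hl' x (hXC x hx) y (hXC y hy) h (h1 x hx hlx))
  constructor
  · obtain ⟨a, a', haa, hD⟩ := card_eq_two.1 (by omega : #{x ∈ X | G.Adj l x} = 2)
    have hmem : ∀ x, x ∈ X ∧ G.Adj l x ↔ x = a ∨ x = a' := fun x => by
      rw [← mem_filter, hD, mem_insert, mem_singleton]
    obtain ⟨haX, hla⟩ := (hmem a).2 (Or.inl rfl)
    obtain ⟨haX', hla'⟩ := (hmem a').2 (Or.inr rfl)
    have hnot : ∀ x ∈ X, G.Adj l x → ¬ G.Adj l' x := fun x hx hlx =>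
      fun h => disjoint_left.1 hdisj (mem_filter.2 ⟨hx, hlx⟩) (mem_filter.2 ⟨hx, h⟩)
    refine ⟨a, haX, a', haX', haa, ?_, hnot a haX hla, hnot a' haX' hla'⟩
    -- If `a` and `a'` were not adjacent, each would be an end of the same arc around `l`.
    by_contra hn
    have hC : ∀ x, x = a ∨ x = a' → T.nxt l x ∈ C := by
      intro x hx
      obtain ⟨hxX, hlx⟩ := (hmem x).2 hx
      refine (hX x hxX _ (T.adj_link hlx)).resolve_left fun hy => ?_
      have hlink := T.adj_link hlx
      rcases hx with rfl | rfl <;> rcases (hmem _).1 ⟨hy, T.adj_nxt hlx⟩ with h | h <;>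
        rw [h] at hlink
      · exact hlink.ne rfl
      · exact hn hlink
      · exact hn hlink.symm
      · exact hlink.ne rfl
    exact haa (hend l hl l' hl' a (hXC a haX) a' (hXC a' haX') hla hla' (h1 a haX hla)
      (h1 a' haX' hla') (hC a (Or.inl rfl)) (hC a' (Or.inr rfl)))
  · intro a ha
    rw [← hcover] at ha
    rcases mem_union.1 ha with ha | ha
    · obtain ⟨haX, hla⟩ := mem_filter.1 ha
      refine c2.trans (card_le_card fun x hx => ?_)
      obtain ⟨hxX, hlx⟩ := mem_filter.1 hx
      exact mem_filter.2 ⟨hxX, fun h => disjoint_left.1 hdisj ha (h ▸ hx),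
        hsep a haX hla x hxX hlx⟩
    · obtain ⟨haX, hla⟩ := mem_filter.1 ha
      refine c1.trans (card_le_card fun x hx => ?_)
      obtain ⟨hxX, hlx⟩ := mem_filter.1 hx
      exact mem_filter.2 ⟨hxX, fun h => disjoint_left.1 hdisj hx (h ▸ ha),
        fun h => hsep x hxX hlx a haX hla h.symm⟩

end Regions

/-- The structure of a spherical triangulation with a complete subgraph `C` of order four, the
deletion of which leaves two parts of order four that are both well joined to `C`. -/
theorem structure_of_clique [Fintype V] (hT : T.IsSpherical) {C A B : Finset V} (hC : #C = 4)
    (hclique : ∀ u ∈ C, ∀ v ∈ C, u ≠ v → G.Adj u v) (hAB : Disjoint A B)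
    (hAC : ∀ x ∈ A, x ∉ C) (hA : ∀ x ∈ A, ∀ y, G.Adj x y → y ∈ A ∨ y ∈ C)
    (hBC : ∀ x ∈ B, x ∉ C) (hB : ∀ x ∈ B, ∀ y, G.Adj x y → y ∈ B ∨ y ∈ C)
    (hA4 : #A = 4) (hB4 : #B = 4) (hA2 : ∀ c ∈ C, 2 ≤ #{x ∈ A | G.Adj c x})
    (hB2 : ∀ c ∈ C, 2 ≤ #{x ∈ B | G.Adj c x}) :
    (∀ c ∈ C, (∃ a ∈ A, ∃ a' ∈ A, a ≠ a' ∧ G.Adj a a' ∧ ¬ G.Adj c a ∧ ¬ G.Adj c a') ∨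
      ∃ b ∈ B, ∃ b' ∈ B, b ≠ b' ∧ G.Adj b b' ∧ ¬ G.Adj c b ∧ ¬ G.Adj c b') ∧
    (∀ a ∈ A, 2 ≤ #{x ∈ A | a ≠ x ∧ ¬ G.Adj a x}) ∧
    (∀ b ∈ B, 2 ≤ #{x ∈ B | b ≠ x ∧ ¬ G.Adj b x}) := by
  obtain ⟨Reg, hadj, hself, huniq, hend⟩ := exists_regions hT hC hclique
  have hne : C.Nonempty := card_pos.1 (by omega)
  have a1 := one_lt_card_seen huniq hAC hA2 hne
  have b1 := one_lt_card_seen huniq hBC hB2 hne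
  have hdisj : Disjoint ({l ∈ C | ∃ c ∈ C, ∃ x ∈ A, G.Adj c x ∧ Reg l x} : Finset V)
      {l ∈ C | ∃ c ∈ C, ∃ x ∈ B, G.Adj c x ∧ Reg l x} := by
    rw [disjoint_left]
    intro l hlA hlB
    exact not_seen_both hC hclique T hadj hself hend hAB hAC hA hBC hB (mem_filter.1 hlA).1
      (mem_filter.1 hlA).2 (mem_filter.1 hlB).2
  have hsub : ({l ∈ C | ∃ c ∈ C, ∃ x ∈ A, G.Adj c x ∧ Reg l x} ∪
      {l ∈ C | ∃ c ∈ C, ∃ x ∈ B, G.Adj c x ∧ Reg l x} : Finset V) ⊆ C :=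
    union_subset (filter_subset _ _) (filter_subset _ _)
  have hcard := card_le_card hsub
  -- Two disjoint sets of at least two regions among four: each part occupies exactly two.
  rw [card_union_of_disjoint hdisj, hC] at hcard
  have hcover := eq_of_subset_of_card_le hsub (by rw [card_union_of_disjoint hdisj]; omega)
  obtain ⟨l, l', -, hll⟩ := card_eq_two.1
    (by omega : #{l ∈ C | ∃ c ∈ C, ∃ x ∈ A, G.Adj c x ∧ Reg l x} = 2)
  obtain ⟨m, m', -, hmm⟩ := card_eq_two.1
    (by omega : #{l ∈ C | ∃ c ∈ C, ∃ x ∈ B, G.Adj c x ∧ Reg l x} = 2)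
  have hl : l ∈ C := filter_subset _ _ (hll ▸ mem_insert_self l {l'})
  have hl' : l' ∈ C :=
    filter_subset _ _ (hll ▸ mem_insert_of_mem (mem_singleton_self l'))
  have hm : m ∈ C := filter_subset _ _ (hmm ▸ mem_insert_self m {m'})
  have hm' : m' ∈ C :=
    filter_subset _ _ (hmm ▸ mem_insert_of_mem (mem_singleton_self m'))
  have r1 := fun x hx h => reg_of_seen_eq_pair (x := x) huniq hAC hl hll hx h
  have r2 := fun x hx h => reg_of_seen_eq_pair (x := x) huniq hAC hl'
    (hll.trans (pair_comm _ _)) hx h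
  have r3 := fun x hx h => reg_of_seen_eq_pair (x := x) huniq hBC hm hmm hx h
  have r4 := fun x hx h => reg_of_seen_eq_pair (x := x) huniq hBC hm'
    (hmm.trans (pair_comm _ _)) hx h
  have s1 := structure_of_seen T hadj hself hend hA4 hA2 hAC hA hl hl' r1
  have s2 := structure_of_seen T hadj hself hend hA4 hA2 hAC hA hl' hl r2
  have s3 := structure_of_seen T hadj hself hend hB4 hB2 hBC hB hm hm' r3
  have s4 := structure_of_seen T hadj hself hend hB4 hB2 hBC hB hm' hm r4
  refine ⟨fun c hc => ?_, s1.2, s3.2⟩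
  rw [← hcover, hll, hmm] at hc
  simp only [mem_union, mem_insert, mem_singleton] at hc
  rcases hc with (rfl | rfl) | rfl | rfl
  · exact Or.inl s2.1
  · exact Or.inl s1.1
  · exact Or.inr s4.1
  · exact Or.inr s3.1

end Triangulation

/-! ### Contradiction in the two cases -/

namespace IsSplit

open Classical Finset

variable {V : Type*} {A B : Finset V} {c c' d d' : V} {G : SimpleGraph V}

theorem ne_of_mem_left (h : IsSplit Gᶜ A B c c' d d') {a : V} (ha : a ∈ A) : c ≠ a :=
  fun e => (h.notMem c (by simp)).1 (e ▸ ha)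

theorem adj_of_not_adj_compl (h : IsSplit Gᶜ A B c c' d d') :
    G.Adj c d ∧ G.Adj c d' ∧ G.Adj c' d ∧ G.Adj c' d' := by
  have h3 := h.nodup
  simp only [List.nodup_cons, List.mem_cons, List.not_mem_nil, or_false, not_or] at h3
  have h4 := h.not_adj
  simp only [SimpleGraph.compl_adj, not_and, not_not] at h4
  exact ⟨h4.1 h3.1.2.1, h4.2.1 h3.1.2.2, h4.2.2.1 h3.2.1.1, h4.2.2.2 h3.2.1.2⟩

theorem mem_or_mem_of_adj (h : IsSplit Gᶜ A B c c' d d') {a y : V} (ha : a ∈ A)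
    (hay : G.Adj a y) : y ∈ A ∨ y ∈ ({c, c', d, d'} : Finset V) := by
  have h1 : y ∉ B := fun hy => (h.adj a ha y hy).2 hay
  have h2 := h.cover y
  simp only [mem_insert, mem_singleton]
  tauto

variable [Fintype V]

/-- The degree sum is at least 32 from `A` to `B` and back, 8 + 8 inside them, and 2 · 16 between
them and the other four vertices: 80 instead of 72. -/
theorem false_of_degIn {H : SimpleGraph V} (h : IsSplit H A B c c' d d')
    (hE : Nat.card H.edgeSet = 36) (hA : ∀ a ∈ A, 2 ≤ H.degIn A a) (hB : ∀ b ∈ B, 2 ≤ H.degIn B b)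
    (hC : ∀ v ∈ [c, c', d, d'], 4 ≤ H.degIn A v + H.degIn B v) : False := by
  have h1 : ∑ v, ∑ x, (if H.Adj v x then 1 else 0) = 72 := by
    have h2 := Triangulation.card_darts (G := H)
    rw [hE, card_filter, Fintype.sum_prod_type] at h2
    exact h2
  have hsum : ∀ v, (∑ a ∈ A, if H.Adj a v then 1 else 0) = H.degIn A v := fun v => by
    simp only [SimpleGraph.degIn, card_filter, H.adj_comm v]
  have hsum' : ∀ v, (∑ b ∈ B, if H.Adj b v then 1 else 0) = H.degIn B v := fun v => by
    simp only [SimpleGraph.degIn, card_filter, H.adj_comm v]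
  have hdeg : ∀ (S : Finset V) (v : V), (∑ x ∈ S, if H.Adj v x then 1 else 0) = H.degIn S v :=
    fun S v => by rw [SimpleGraph.degIn, card_filter]
  rw [h.sum_eq] at h1
  simp only [h.sum_eq, sum_add_distrib, hdeg, hsum, hsum'] at h1
  have e1 : ∑ a ∈ A, H.degIn B a = 16 := by
    rw [sum_congr rfl (g := fun _ => 4) fun a ha => by
      rw [SimpleGraph.degIn, filter_true_of_mem fun b hb => h.adj a ha b hb, h.cardB],
      sum_const, h.cardA]
    rfl
  have e2 : ∑ b ∈ B, H.degIn A b = 16 := by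
    rw [sum_congr rfl (g := fun _ => 4) fun b hb => by
      rw [SimpleGraph.degIn, filter_true_of_mem fun a ha => (h.adj a ha b hb).symm, h.cardA],
      sum_const, h.cardB]
    rfl
  have e3 := card_nsmul_le_sum A (fun a => H.degIn A a) 2 hA
  have e4 := card_nsmul_le_sum B (fun b => H.degIn B b) 2 hB
  rw [h.cardA] at e3
  rw [h.cardB] at e4
  have f1 := hC c (by simp)
  have f2 := hC c' (by simp)
  have f3 := hC d (by simp)
  have f4 := hC d' (by simp)
  simp only [smul_eq_mul] at e3 e4
  omega

theorem two_le_common (h : IsSplit Gᶜ A B c c' d d') (T : Triangulation Gᶜ)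
    (hH : Gᶜ.Connected) (hE : Nat.card Gᶜ.edgeSet = 36) (hcc : Gᶜ.Adj c c') :
    2 ≤ #{a ∈ A | G.Adj c a ∧ G.Adj c' a} := by
  have h1 : #{a ∈ A | Gᶜ.Adj c a ∨ Gᶜ.Adj c' a} ≤ 2 := by
    convert h.card_union_le_two T hH hE hcc
  have h2 := card_filter_add_card_filter_not (s := A) (fun a => Gᶜ.Adj c a ∨ Gᶜ.Adj c' a)
  rw [h.cardA] at h2
  have h3 : ({a ∈ A | ¬ (Gᶜ.Adj c a ∨ Gᶜ.Adj c' a)} : Finset V) =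
      {a ∈ A | G.Adj c a ∧ G.Adj c' a} := by
    apply filter_congr
    intro a ha
    have n1 := h.ne_of_mem_left ha
    have n2 := h.swap_left.ne_of_mem_left ha
    simp [n1, n2]
  rw [h3] at h2
  omega

theorem two_le_adj (h : IsSplit Gᶜ A B c c' d d') (T : Triangulation Gᶜ)
    (hH : Gᶜ.Connected) (hE : Nat.card Gᶜ.edgeSet = 36) : 2 ≤ #{a ∈ A | G.Adj c a} := by
  have h1 : #{a ∈ A | Gᶜ.Adj c a} ≤ 2 := by
    have h2 := h.degIn_le_two T hH hE
    rw [SimpleGraph.degIn] at h2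
    convert h2
  have h2 := card_filter_add_card_filter_not (s := A) (fun a => Gᶜ.Adj c a)
  rw [h.cardA] at h2
  have h3 : ({a ∈ A | ¬ Gᶜ.Adj c a} : Finset V) = {a ∈ A | G.Adj c a} := by
    apply filter_congr
    intro a ha
    simp [h.ne_of_mem_left ha]
  rw [h3] at h2
  omega

theorem false_of_adj_compl (h : IsSplit Gᶜ A B c c' d d') {S : Triangulation G}
    (hS : S.IsSpherical) (T : Triangulation Gᶜ) (hH : Gᶜ.Connected)
    (hE : Nat.card Gᶜ.edgeSet = 36) (hcc : Gᶜ.Adj c c') : False := by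
  have h1 := h.two_le_common T hH hE hcc
  have h2 := h.swap_sides.two_le_common T hH hE hcc
  obtain ⟨a, ha⟩ := card_pos.1 (by omega : 0 < #{a ∈ A | G.Adj c a ∧ G.Adj c' a})
  obtain ⟨b, hb⟩ := card_pos.1 (by omega : 0 < #{b ∈ B | G.Adj c b ∧ G.Adj c' b})
  obtain ⟨haA, hca, hca'⟩ := mem_filter.1 ha
  obtain ⟨hbB, hcb, hcb'⟩ := mem_filter.1 hb
  obtain ⟨hcd, hcd', -, -⟩ := h.adj_of_not_adj_compl
  refine Triangulation.false_of_quadrilateral hS h (fun h => hcc.2 h) haA hbB hca hca' hcb hcb'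
    hcd hcd' ?_
  -- If `d d'` is an edge of the complement too, `d` and `d'` have two common neighbours in `A`, one
  -- of which is not `a`.
  by_cases hdd : G.Adj d d'
  · exact Or.inl hdd
  · have h3 := h.nodup
    simp only [List.nodup_cons, List.mem_cons, List.not_mem_nil, or_false, not_or] at h3
    have h4 := h.swap_pairs.two_le_common T hH hE ⟨h3.2.2.1, hdd⟩
    obtain ⟨a', ha', hne⟩ := exists_mem_ne
      (by omega : 1 < #{a ∈ A | G.Adj d a ∧ G.Adj d' a}) a
    obtain ⟨haA', hda, hda'⟩ := mem_filter.1 ha'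
    exact Or.inr ⟨a', haA', hne, hda, hda'⟩

/-- Each vertex of the clique misses two vertices that are adjacent in `G`. In the complement these
are non-adjacent neighbours of it, which raises its degree to four. -/
theorem false_of_clique (h : IsSplit Gᶜ A B c c' d d') {S : Triangulation G}
    (hS : S.IsSpherical) (T : Triangulation Gᶜ) (hH : Gᶜ.Connected)
    (hE : Nat.card Gᶜ.edgeSet = 36) (hcc : ¬ Gᶜ.Adj c c') (hdd : ¬ Gᶜ.Adj d d') : False := by
  have hn := h.nodup
  simp only [List.nodup_cons, List.mem_cons, List.not_mem_nil, or_false, not_or, ← ne_eq] at hn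
  obtain ⟨⟨ncc', ncd, ncd'⟩, ⟨nc'd, nc'd'⟩, ndd', -⟩ := hn
  obtain ⟨g1, g2, g3, g4⟩ := h.adj_of_not_adj_compl
  have g5 : G.Adj c c' := by simpa [ncc'] using hcc
  have g6 : G.Adj d d' := by simpa [ndd'] using hdd
  have hmem : ∀ v, v ∈ ({c, c', d, d'} : Finset V) ↔ v ∈ [c, c', d, d'] := fun v => by simp
  have hclique : ∀ u ∈ ({c, c', d, d'} : Finset V), ∀ v ∈ ({c, c', d, d'} : Finset V),
      u ≠ v → G.Adj u v := by
    intro u hu v hv huv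
    simp only [mem_insert, mem_singleton] at hu hv
    rcases hu with rfl | rfl | rfl | rfl <;> rcases hv with rfl | rfl | rfl | rfl <;>
      first
      | exact absurd rfl huv
      | assumption
      | exact SimpleGraph.Adj.symm (by assumption)
  have hC4 : #({c, c', d, d'} : Finset V) = 4 := by
    rw [card_insert_of_notMem (by simp [ncc', ncd, ncd']), card_eq_three.2
      ⟨c', d, d', nc'd, nc'd', ndd', rfl⟩]
  have hall : ∀ {A B : Finset V}, IsSplit Gᶜ A B c c' d d' →
      ∀ v ∈ ({c, c', d, d'} : Finset V), 2 ≤ #{x ∈ A | G.Adj v x} := by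
    intro A B h v hv
    simp only [mem_insert, mem_singleton] at hv
    rcases hv with rfl | rfl | rfl | rfl
    · exact h.two_le_adj T hH hE
    · exact h.swap_left.two_le_adj T hH hE
    · exact h.swap_pairs.two_le_adj T hH hE
    · exact h.swap_pairs.swap_left.two_le_adj T hH hE
  have hfour : ∀ {A B : Finset V}, IsSplit Gᶜ A B c c' d d' →
      ∀ v ∈ ({c, c', d, d'} : Finset V),
      (∃ a ∈ A, ∃ a' ∈ A, a ≠ a' ∧ G.Adj a a' ∧ ¬ G.Adj v a ∧ ¬ G.Adj v a') →
      4 ≤ Gᶜ.degIn A v + Gᶜ.degIn B v := by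
    rintro A B h v hv ⟨a, ha, a', ha', haa, hadj, hva, hva'⟩
    have hn : ¬ Gᶜ.Adj a a' := fun h => h.2 hadj
    have m1 := (h.notMem v ((hmem v).1 hv)).1
    have k1 : Gᶜ.Adj v a := ⟨fun e => m1 (e ▸ ha), hva⟩
    have k2 : Gᶜ.Adj v a' := ⟨fun e => m1 (e ▸ ha'), hva'⟩
    simp only [mem_insert, mem_singleton] at hv
    rcases hv with rfl | rfl | rfl | rfl
    · exact h.four_le_degree_of_not_adj T hH hcc haa k1 k2 hn
    · exact h.swap_left.four_le_degree_of_not_adj T hH (fun e => hcc e.symm) haa k1 k2 hn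
    · exact h.swap_pairs.four_le_degree_of_not_adj T hH hdd haa k1 k2 hn
    · exact h.swap_pairs.swap_left.four_le_degree_of_not_adj T hH (fun e => hdd e.symm) haa
        k1 k2 hn
  obtain ⟨h1, h2, h3⟩ := Triangulation.structure_of_clique hS hC4 hclique h.disj
    (fun x hx hxC => (h.notMem x ((hmem x).1 hxC)).1 hx)
    (fun x hx y hxy => h.mem_or_mem_of_adj hx hxy)
    (fun x hx hxC => (h.notMem x ((hmem x).1 hxC)).2 hx)
    (fun x hx y hxy => h.swap_sides.mem_or_mem_of_adj hx hxy) h.cardA h.cardB (hall h)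
    (hall h.swap_sides)
  have hdeg : ∀ (X : Finset V) (a : V), #{x ∈ X | a ≠ x ∧ ¬ G.Adj a x} = Gᶜ.degIn X a :=
    fun X a => by
      rw [SimpleGraph.degIn]
      congr 1
      ext x
      simp
  simp only [hdeg] at h2 h3
  refine h.false_of_degIn hE h2 h3 fun v hv => ?_
  rcases h1 v ((hmem v).2 hv) with h4 | h4
  · exact hfour h v ((hmem v).2 hv) h4
  · rw [add_comm]
    exact hfour h.swap_sides v ((hmem v).2 hv) h4

end IsSplit

/-! ### Edge count and conclusion -/

open Classical Finset in
theorem SimpleGraph.natCard_edgeSet_add_compl {V : Type*} [Fintype V] (G : SimpleGraph V) :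
    2 * Nat.card G.edgeSet + 2 * Nat.card Gᶜ.edgeSet = Fintype.card V * (Fintype.card V - 1) := by
  rw [← Triangulation.card_darts, ← Triangulation.card_darts, Nat.mul_sub_one, ← card_univ,
    ← offDiag_card, ← card_filter_add_card_filter_not (s := offDiag univ)
      (fun p : V × V => G.Adj p.1 p.2)]
  congr 2
  · ext p
    simp only [mem_filter, mem_univ, true_and, mem_offDiag]
    exact ⟨fun h => ⟨h.ne, h⟩, fun h => h.2⟩
  · ext p
    simp [SimpleGraph.compl_adj]

open Classical Finset in
theorem IsPT12.not_isSplit {V : Type*} [Fintype V] {G : SimpleGraph V} (hG : IsPT12 G)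
    {A B : Finset V} {c c' d d' : V} (h : IsSplit Gᶜ A B c c' d d') : False := by
  obtain ⟨hV, hp, ht⟩ := hG
  rw [Nat.card_eq_fintype_card] at hV
  obtain ⟨p1, p2⟩ := EmbedsInSurface.card_edges hp (by omega)
  obtain ⟨t1, t2⟩ := EmbedsInSurface.card_edges ht (by omega)
  have hE := G.natCard_edgeSet_add_compl
  rw [hV] at hE p1 p2 t1 t2
  -- The bounds 30 and 36 add up to 66, so both are attained.
  obtain ⟨-, S, hS⟩ := p2 (by omega)
  obtain ⟨hH, T, -⟩ := t2 (by omega)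
  have hE' : Nat.card Gᶜ.edgeSet = 36 := by omega
  by_cases hcc : Gᶜ.Adj c c'
  · exact h.false_of_adj_compl (hS rfl) T hH hE' hcc
  · by_cases hdd : Gᶜ.Adj d d'
    · exact h.swap_pairs.false_of_adj_compl (hS rfl) T hH hE' hdd
    · exact h.false_of_clique (hS rfl) T hH hE' hcc hdd

theorem mainTheorem4 {V : Type*} [Finite V] (G : SimpleGraph V) (hG : IsPT12 G) :
    ¬ ∃ (u : V) (C : G.Walk u u) (A B : Set V),
        C.IsCycle ∧ C.length = 4 ∧
        DeletionLeaves G {v | v ∈ C.support} A B ∧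
        A.ncard = 4 ∧ B.ncard = 4 := by
  classical
  have := Fintype.ofFinite V
  rintro ⟨u, C, A, B, hC, hlen, ⟨hcover, hdisj, hAB⟩, hA, hB⟩
  match C, hC, hlen, hcover with
  | .cons (v := v) h1 (.cons (v := w) h2 (.cons (v := x) h3 (.cons h4 .nil))), hC, _, hcover =>
    have hn := hC.support_nodup
    simp only [SimpleGraph.Walk.support_cons, SimpleGraph.Walk.support_nil, List.tail_cons] at hn
    have hmem : ∀ y, y ∈ A ∪ B ↔ y ∉ [u, w, v, x] := fun y => by
      rw [hcover]
      simp only [SimpleGraph.Walk.support_cons, SimpleGraph.Walk.support_nil, Set.mem_compl_iff,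
        Set.mem_ofPred_eq, List.mem_cons, List.not_mem_nil]
      tauto
    -- The cycle is u v w x, so its opposite pairs are u, w and v, x.
    refine hG.not_isSplit (A := A.toFinset) (B := B.toFinset) (c := u) (c' := w) (d := v)
      (d' := x) ⟨fun y => ?_, ?_, ?_, fun y hy => ?_, ?_, ?_, ?_, ?_⟩
    · have := hmem y
      simp only [Set.mem_union, List.mem_cons, List.not_mem_nil] at this
      simp only [Set.mem_toFinset]
      tauto
    · rwa [Set.disjoint_toFinset]
    · simp only [List.nodup_cons, List.mem_cons, List.not_mem_nil] at hn ⊢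
      grind
    · have := hmem y
      simp only [Set.mem_union] at this
      simp only [Set.mem_toFinset]
      tauto
    · intro a ha b hb
      rw [Set.mem_toFinset] at ha hb
      exact ⟨fun e => Set.disjoint_left.1 hdisj ha (e ▸ hb), hAB a ha b hb⟩
    · exact ⟨fun h => h.2 h1, fun h => h.2 h4.symm, fun h => h.2 h2.symm, fun h => h.2 h3⟩
    · rw [← Set.ncard_eq_toFinset_card', hA]
    · rw [← Set.ncard_eq_toFinset_card', hB]
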